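/- Let $\mathbb{R}^3_1$ be $\mathbb{R}^3$ with the pseudo scalar product $\langle x,y\rangle=-x_1y_1+x_2y_2+x_3y_3$ and the pseudo vector product $x\wedge y=(-(x_2y_3-x_3y_2),\,x_3y_1-x_1y_3,\,x_1y_2-x_2y_1)$, and put $H^2=\{x\mid\langle x,x\rangle=-1,\ x_1>0\}$, $S^2_1=\{x\mid\langle x,x\rangle=1\}$ and $\Delta_1=\{(v,w)\in H^2\times S^2_1\mid\langle v,w\rangle=0\}$. Let $I\subset\mathbb{R}$ be an interval with more than one point (derivatives, and germs, are taken along $I$, hence one-sided at an endpoint belonging to $I$). Let $(\gamma,\nu):I\to\Delta_1$ be a spacelike Legendre curve, i.e. a $C^\infty$ map with $\langle\dot\gamma(t),\nu(t)\rangle=0$ for all $t\in I$. Put $\mu=\gamma\wedge\nu$, and let $(m,n)$ be its curvature, defined by $\dot\gamma=m\mu$, $\dot\nu=n\mu$, $\dot\mu=m\gamma-n\nu$ on $I$. Fix a sign $\pm$ (the same choice throughout), let $s_\pm:I\to\mathbb{R}$ be a solution on $I$ of the Riccati equation $$\dot s_\pm(t)=\frac{m(t)\pm n(t)}{2}\,s_\pm^2(t)-m(t),$$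 and let $$Inv^\pm(\gamma,s_\pm)(t)=\gamma(t)+s_\pm(t)\mu(t)+\frac{s_\pm^2(t)}{2}\bigl(\gamma(t)\pm\nu(t)\bigr)$$ be the corresponding horocyclic involute of $\gamma$. A curve $c:I\to H^2$ is singular at $t_0\in I$ if $\dot c(t_0)=0$. It has an $(i,j)$-cusp at $t_0$ if its germ at $t_0$ is $\mathcal{A}$-equivalent to the germ of $u\mapsto(u^i,u^j)$ at the origin, i.e. if there are germs of $C^\infty$ diffeomorphisms $\varphi:(\mathbb{R},t_0)\to(\mathbb{R},0)$ and $\Phi:(H^2,c(t_0))\to(\mathbb{R}^2,0)$ with $\Phi(c(t))=(\varphi(t)^i,\varphi(t)^j)$ for all $t\in I$ near $t_0$. Then for every $t_0\in I$: 1. $Inv^\pm(\gamma,s_\pm)$ is singular at $t_0$ if and only if $s_\pm(t_0)\,(n(t_0)\pm m(t_0))=0$. 2. $Inv^\pm(\gamma,s_\pm)$ has a $(2,3)$-cusp at $t_0$ if and only if $s_\pm(t_0)=0$, $m(t_0)\neq0$ and $n(t_0)\pm m(t_0)\neq0$. 3. $Inv^\pm(\gamma,s_\pm)$ has a $(3,4)$-cusp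 at $t_0$ if and only if $s_\pm(t_0)=0$, $m(t_0)=0$, $n(t_0)\neq0$ and $\dot m(t_0)\neq0$. 4. $Inv^\pm(\gamma,s_\pm)$ has a $(2,5)$-cusp at $t_0$ if and only if $n(t_0)\pm m(t_0)=0$, $\dot n(t_0)\pm\dot m(t_0)\neq0$, $s_\pm(t_0)\neq0$ and $m(t_0)\neq0$. 5. $Inv^\pm(\gamma,s_\pm)$ has a $(3,5)$-cusp at $t_0$ if and only if $s_\pm(t_0)=0$, $n(t_0)\pm m(t_0)=0$, $\dot n(t_0)\pm\dot m(t_0)\neq0$ and $m(t_0)\neq0$. -/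

import Mathlib

open Set Filter Topology
open scoped ContDiff

noncomputable section

/-- The pseudo scalar product `-x₁y₁ + x₂y₂ + x₃y₃` of Lorentz-Minkowski 3-space. -/
def lorentz (x y : Fin 3 → ℝ) : ℝ := -(x 0 * y 0) + x 1 * y 1 + x 2 * y 2

/-- The pseudo vector product: the formal determinant with rows `(-e₁, e₂, e₃)`, `x`, `y`. -/
def wedge (x y : Fin 3 → ℝ) : Fin 3 → ℝ :=
  ![-(x 1 * y 2 - x 2 * y 1), x 2 * y 0 - x 0 * y 2, x 0 * y 1 - x 1 * y 0]

/-- Hyperbolic 2-space: the branch `x₁ > 0` of the hyperboloid `⟨x, x⟩ = -1`. -/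
def hyperbolicPlane : Set (Fin 3 → ℝ) := {x | lorentz x x = -1 ∧ 0 < x 0}

/-- De Sitter 2-space `⟨x, x⟩ = 1`. -/
def deSitterPlane : Set (Fin 3 → ℝ) := {x | lorentz x x = 1}

/-- `(γ, ν) : I → Δ₁` is a (smooth) spacelike Legendre curve. Derivatives are taken along `I`, so
they are one-sided at an endpoint of `I` that belongs to `I`. -/
structure IsSpacelikeLegendreCurve (I : Set ℝ) (γ ν : ℝ → Fin 3 → ℝ) : Prop where
  smooth_base : ContDiffOn ℝ ∞ γ I
  smooth_normal : ContDiffOn ℝ ∞ ν I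
  base_mem : ∀ t ∈ I, γ t ∈ hyperbolicPlane
  normal_mem : ∀ t ∈ I, ν t ∈ deSitterPlane
  orthogonal : ∀ t ∈ I, lorentz (γ t) (ν t) = 0
  legendre : ∀ t ∈ I, lorentz (derivWithin γ I t) (ν t) = 0

/-- The third vector `μ = γ ∧ ν` of the moving frame `{γ, ν, μ}`. -/
def frameTangent (γ ν : ℝ → Fin 3 → ℝ) (t : ℝ) : Fin 3 → ℝ := wedge (γ t) (ν t)

/-- `(m, n)` is the curvature of `(γ, ν)`: the coefficients in the Frenet type formula
`γ' = m μ`, `ν' = n μ`, `μ' = m γ - n ν` on `I`. -/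
def IsLegendreCurvature (I : Set ℝ) (γ ν : ℝ → Fin 3 → ℝ) (m n : ℝ → ℝ) : Prop :=
  ∀ t ∈ I,
    derivWithin γ I t = m t • frameTangent γ ν t ∧
    derivWithin ν I t = n t • frameTangent γ ν t ∧
    derivWithin (frameTangent γ ν) I t = m t • γ t - n t • ν t

/-- `s` solves on `I` the Riccati equation `s' = (m + ε n) / 2 * s ^ 2 - m`, with `ε = ±1`. -/
def IsInvoluteSolution (I : Set ℝ) (ε : ℝ) (m n s : ℝ → ℝ) : Prop :=
  ∀ t ∈ I, HasDerivWithinAt s ((m t + ε * n t) / 2 * s t ^ 2 - m t) I t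

/-- The horocyclic involute `γ + s μ + (s ^ 2 / 2) (γ + ε ν)`, with `ε = ±1`. -/
def horocyclicInvolute (ε : ℝ) (γ ν : ℝ → Fin 3 → ℝ) (s : ℝ → ℝ) (t : ℝ) : Fin 3 → ℝ :=
  γ t + s t • frameTangent γ ν t + (s t ^ 2 / 2) • (γ t + ε • ν t)

/-- `c : I → ℝ³` is singular at `t₀`: its derivative along `I` vanishes there. -/
def IsSingularAt (I : Set ℝ) (c : ℝ → Fin 3 → ℝ) (t₀ : ℝ) : Prop := derivWithin c I t₀ = 0

/-- `Φ` represents the germ of a diffeomorphism `(S, a) → (T, b)` between subsets of normed spaces: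
it restricts to a bijection between a neighbourhood of `a` in `S` and one of `b` in `T`,
and it and the inverse are restrictions of smooth maps on open sets of the ambient spaces. -/
def IsDiffeoGerm {E F : Type*} [NormedAddCommGroup E] [NormedSpace ℝ E]
    [NormedAddCommGroup F] [NormedSpace ℝ F]
    (S : Set E) (a : E) (T : Set F) (b : F) (Φ : E → F) : Prop :=
  ∃ (Ψ : F → E) (U : Set E) (V : Set F),
    IsOpen U ∧ IsOpen V ∧ a ∈ U ∩ S ∧ b ∈ V ∩ T ∧ Φ a = b ∧
    ContDiffOn ℝ ∞ Φ U ∧ ContDiffOn ℝ ∞ Ψ V ∧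
    MapsTo Φ (U ∩ S) (V ∩ T) ∧ MapsTo Ψ (V ∩ T) (U ∩ S) ∧
    LeftInvOn Ψ Φ (U ∩ S) ∧ RightInvOn Ψ Φ (V ∩ T)

/-- The curve `c : I → H²` has an `(i, j)`-cusp at `t₀`: its germ at `t₀` is `𝒜`-equivalent to the
germ of `u ↦ (u ^ i, u ^ j)` at the origin, i.e. `Φ ∘ c = (φ ^ i, φ ^ j)` near `t₀` in `I` for some
germs of diffeomorphisms `φ : (ℝ, t₀) → (ℝ, 0)` and `Φ : (H², c t₀) → (ℝ², 0)`. -/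
def HasCuspAt (i j : ℕ) (I : Set ℝ) (c : ℝ → Fin 3 → ℝ) (t₀ : ℝ) : Prop :=
  ∃ (φ : ℝ → ℝ) (Φ : (Fin 3 → ℝ) → ℝ × ℝ),
    IsDiffeoGerm univ t₀ univ 0 φ ∧
    IsDiffeoGerm hyperbolicPlane (c t₀) univ 0 Φ ∧
    ∀ᶠ t in 𝓝[I] t₀, Φ (c t) = (φ t ^ i, φ t ^ j)

end

/-!
# Cusps of horocyclic involutes

Put `k = n + ε m` and let `c` be the involute. The vectors
`w = -ν + ε s μ + (s ^ 2 / 2) (ε γ + ν)` and `N = μ + s (γ + ε ν)` form with `c` a Lorentz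
orthonormal frame, also where `c` is singular, and
`c' = s k w`, `w' = s k c - k N`, `N' = k w`.
In particular `c` is singular exactly where `s k = 0`.

The coordinates `x = ⟨c, w(t₀)⟩` and `y = ⟨c, N(t₀)⟩` are a chart of the hyperbolic plane
(`IsLorentzFrame.isDiffeoGerm`), so that the question is one about the plane curve `(x, y)`.
For the four pairs `(i, j)` considered, `c` has an `(i, j)`-cusp at `t₀` if and only if, for some
constant `K`, the function `x` has order exactly `i` and `z = y - K x ^ 2` order exactly `j`
(`hasCuspAt_involute_iff`).

* If the orders are `i` and `j`, the curve `(x, z)` is `F (v ^ i, v ^ j)` for a new parameter `v`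
  and a local diffeomorphism `F` (`isPlaneCusp_of_order`). The parameter is the `i`-th root of the
  first component, and `F` is written down from the decomposition of a smooth function of `v` by
  residues modulo `i` of the exponents, with coefficients that are smooth in `v ^ i`. For `i = 2`
  this is Whitney's theorem on even functions; in general it holds by Borel's lemma, which reduces
  it to flat functions, and these remain smooth when composed with a root. For `i = 3` one exponent
  above `j` (`5` if `j = 4`, `7` if `j = 5`) is not in the semigroup generated by `i` and `j`; its term is
  first removed by a change of coordinates.
* If there is a cusp, `(x, y) = G (φ ^ i, φ ^ j)` for a diffeomorphism `G`. Since the limiting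
  tangent is the first axis, `x` has order `i` and `y` starts with `K x ^ 2` and a multiple of
  `φ ^ j`; other terms are of higher order because `j < 3 i` (`IsInvoluteCoordinates.exists_leading`).

Finally `x' = s k a` and `z' = s k B` with `B' = k g`, where `a(t₀) = 1`, `B(t₀) = 0` and
`g(t₀) = -1 - 2 K s(t₀)`. So the orders of `x` and `z` are known from those of `s k` and `k g`
(`IsInvoluteCoordinates.leading_iff`), and the Riccati equation turns this into the conditions on
`s`, `m`, `n`. The constant `K` matters for the `(2, 5)`-cusp only, where `K = -1 / (2 s(t₀))`
makes `g` vanish and `g'(t₀) = 2 K m(t₀)`.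

At an endpoint of `I` that belongs to `I` all functions are replaced by smooth extensions
(`exists_contDiff_eventuallyEq_nhdsWithin`), which exist by the theorem on even functions: if `f` is
smooth on `[0, δ]`, then `f (v ^ 2)` is even.
-/

/-! ### Hadamard's lemma and Borel's lemma -/

theorem hasDerivAt_integral_pow_mul_comp_mul (j : ℕ) {f : ℝ → ℝ} (hf : ContDiff ℝ ∞ f) (x : ℝ) :
    HasDerivAt (fun x => ∫ t in (0 : ℝ)..1, t ^ j * f (t * x))
      (∫ t in (0 : ℝ)..1, t ^ (j + 1) * deriv f (t * x)) x := by
  have hfc : Continuous f := hf.continuous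
  have hf'c : Continuous (deriv f) := hf.continuous_deriv (by simp)
  obtain ⟨C, hC⟩ := (isCompact_Icc (a := -(|x| + 1)) (b := |x| + 1)).exists_bound_of_continuousOn
    hf'c.continuousOn
  refine (intervalIntegral.hasDerivAt_integral_of_dominated_loc_of_deriv_le
    (F := fun x t => t ^ j * f (t * x)) (F' := fun x t => t ^ (j + 1) * deriv f (t * x))
    (bound := fun _ => C) (s := Metric.ball x 1) (Metric.ball_mem_nhds x one_pos)
    (Eventually.of_forall fun y => ?_) ?_ ?_ ?_ ?_ ?_).2
  · exact (Continuous.aestronglyMeasurable (by fun_prop))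
  · exact (Continuous.intervalIntegrable (by fun_prop) _ _)
  · exact (Continuous.aestronglyMeasurable (by fun_prop))
  · refine Eventually.of_forall fun t ht y hy => ?_
    rw [uIoc_of_le zero_le_one] at ht
    have hy' : |y| ≤ |x| + 1 := by
      have h1 : |y - x| < 1 := by simpa [Real.dist_eq] using hy
      have h2 := abs_sub_abs_le_abs_sub y x
      linarith
    have hty : |t * y| ≤ |x| + 1 := by
      rw [abs_mul, abs_of_pos ht.1]
      calc t * |y| ≤ 1 * |y| := by gcongr; exact ht.2
        _ ≤ _ := by linarith
    have h3 := hC (t * y) (abs_le.1 hty)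
    rw [norm_mul, norm_pow, Real.norm_of_nonneg ht.1.le]
    calc t ^ (j + 1) * ‖deriv f (t * y)‖ ≤ 1 * ‖deriv f (t * y)‖ := by
          gcongr; exact pow_le_one₀ ht.1.le ht.2
      _ ≤ C := by linarith
  · exact intervalIntegrable_const
  · refine Eventually.of_forall fun t _ y _ => ?_
    have h1 : HasDerivAt f (deriv f (t * y)) (t * y) :=
      (hf.differentiable (by simp)).differentiableAt.hasDerivAt
    have h2 := (h1.comp y ((hasDerivAt_id y).const_mul t)).const_mul (t ^ j)
    exact h2.congr_deriv (by ring)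

theorem contDiff_integral_pow_mul_comp_mul (j : ℕ) {f : ℝ → ℝ} (hf : ContDiff ℝ ∞ f) :
    ContDiff ℝ ∞ (fun x => ∫ t in (0 : ℝ)..1, t ^ j * f (t * x)) := by
  rw [contDiff_infty]
  intro n
  induction n generalizing j f with
  | zero =>
    exact contDiff_zero.2 (continuous_iff_continuousAt.2 fun x =>
      (hasDerivAt_integral_pow_mul_comp_mul j hf x).continuousAt)
  | succ n ih =>
    push_cast
    rw [contDiff_succ_iff_deriv]
    refine ⟨fun x => (hasDerivAt_integral_pow_mul_comp_mul j hf x).differentiableAt,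
      by simp, ?_⟩
    rw [funext fun x => (hasDerivAt_integral_pow_mul_comp_mul j hf x).deriv]
    exact ih (j + 1) (contDiff_infty_iff_deriv.1 hf).2

/-- Hadamard's lemma on the line. -/
theorem exists_eq_add_sub_mul {f : ℝ → ℝ} (hf : ContDiff ℝ ∞ f) (a : ℝ) :
    ∃ g : ℝ → ℝ, ContDiff ℝ ∞ g ∧ ∀ x, f x = f a + (x - a) * g x := by
  have hF : ContDiff ℝ ∞ fun y => f (a + y) := hf.comp (contDiff_const.add contDiff_id)
  have hF' : ContDiff ℝ ∞ fun y => deriv f (a + y) :=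
    (contDiff_infty_iff_deriv.1 hf).2.comp (contDiff_const.add contDiff_id)
  refine ⟨fun x => ∫ t in (0 : ℝ)..1, t ^ 0 * deriv f (a + t * (x - a)), ?_, fun x => ?_⟩
  · exact (contDiff_integral_pow_mul_comp_mul 0 hF').comp (contDiff_id.sub contDiff_const)
  · have h := intervalIntegral.integral_eq_sub_of_hasDerivAt
      (f := fun t => f (a + t * (x - a))) (f' := fun t => (x - a) * deriv f (a + t * (x - a)))
      (a := 0) (b := 1) (fun t _ => ?_) ?_
    · simp only [pow_zero, one_mul, zero_mul, add_zero, intervalIntegral.integral_const_mul] at h ⊢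
      rw [h]; ring_nf
    · have h1 : HasDerivAt f (deriv f (a + t * (x - a))) (a + t * (x - a)) :=
        (hf.differentiable (by simp)).differentiableAt.hasDerivAt
      have h2 := h1.comp t (((hasDerivAt_id t).mul_const (x - a)).const_add a)
      exact h2.congr_deriv (by ring)
    · have : Continuous (deriv f) := hf.continuous_deriv (by simp)
      exact Continuous.intervalIntegrable (by fun_prop) _ _

/-- Taylor's formula to every order, with a smooth quotient as remainder term. -/
theorem exists_taylor {f : ℝ → ℝ} (hf : ContDiff ℝ ∞ f) :
    ∃ c : ℕ → ℝ, ∀ N, ∃ g : ℝ → ℝ, ContDiff ℝ ∞ g ∧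
      ∀ x, f x = (∑ n ∈ Finset.range N, c n * x ^ n) + x ^ N * g x := by
  choose! G hG hG' using fun (f : ℝ → ℝ) (hf : ContDiff ℝ ∞ f) => exists_eq_add_sub_mul hf 0
  have hs : ∀ N, ContDiff ℝ ∞ (G^[N] f) := fun N => by
    induction N with
    | zero => exact hf
    | succ N ih => rw [Function.iterate_succ_apply']; exact hG _ ih
  refine ⟨fun n => (G^[n] f) 0, fun N => ⟨G^[N] f, hs N, fun x => ?_⟩⟩
  induction N with
  | zero => simp
  | succ N ih =>
    rw [ih, Finset.sum_range_succ, Function.iterate_succ_apply', hG' _ (hs N) x]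
    ring

/-- A smooth function which is `O(x ^ N)` off the origin is divisible by `x ^ N`. -/
theorem exists_eq_pow_mul_of_isBigO {f : ℝ → ℝ} (hf : ContDiff ℝ ∞ f) (N : ℕ)
    (h : f =O[𝓝[≠] 0] fun x : ℝ => x ^ N) :
    ∃ g : ℝ → ℝ, ContDiff ℝ ∞ g ∧ ∀ x, f x = x ^ N * g x := by
  induction N generalizing f with
  | zero => exact ⟨f, hf, by simp⟩
  | succ N ih =>
    have h0 : f 0 = 0 := by
      have h1 : Tendsto f (𝓝[≠] 0) (𝓝 0) := h.trans_tendsto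
        (((continuous_pow (M := ℝ) (N + 1)).tendsto' 0 0 (by simp)).mono_left nhdsWithin_le_nhds)
      exact tendsto_nhds_unique
        (hf.continuous.continuousAt.tendsto.mono_left nhdsWithin_le_nhds) h1
    obtain ⟨g, hg, hfg⟩ := exists_eq_add_sub_mul hf 0
    obtain ⟨k, hk, hgk⟩ := ih hg (by
      obtain ⟨C, hC⟩ := h.bound
      refine Asymptotics.IsBigO.of_bound C ?_
      filter_upwards [hC, self_mem_nhdsWithin] with x hx hx0
      have hx0' : 0 < ‖x‖ := norm_pos_iff.2 hx0
      rw [hfg, h0, pow_succ', sub_zero, zero_add, norm_mul, norm_mul] at hx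
      nlinarith)
    exact ⟨k, hk, fun x => by rw [hfg, h0, hgk]; ring⟩

/-- Borel's lemma: every formal power series is the Taylor series of a smooth function. -/
theorem exists_contDiff_taylor (a : ℕ → ℝ) :
    ∃ f : ℝ → ℝ, ContDiff ℝ ∞ f ∧
      ∀ N, (fun x => f x - ∑ n ∈ Finset.range N, a n * x ^ n) =O[𝓝 0] fun x : ℝ => x ^ N := by
  let χ : ContDiffBump (0 : ℝ) := ⟨1, 2, one_pos, one_lt_two⟩
  let h : ℕ → ℝ → ℝ := fun n y => y ^ n * χ y
  have hh : ∀ n, ContDiff ℝ ∞ (h n) := fun n => (contDiff_id.pow n).mul χ.contDiff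
  have hb : ∀ n k : ℕ, ∃ C, ∀ y, ‖iteratedDeriv k (h n) y‖ ≤ C := fun n k => by
    have hc : HasCompactSupport (h n) := χ.hasCompactSupport.mul_left
    obtain ⟨C, hC⟩ := ((hh n).continuous_iteratedFDeriv (m := k)
      (by exact_mod_cast le_top)).bounded_above_of_compact_support (hc.iteratedFDeriv (𝕜 := ℝ) k)
    exact ⟨C, fun y => by rw [← norm_iteratedFDeriv_eq_norm_iteratedDeriv]; exact hC y⟩
  choose C hC using hb
  have hC0 : ∀ n k, 0 ≤ C n k := fun n k => (norm_nonneg _).trans (hC n k 0)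
  let M : ℕ → ℝ := fun n => ∑ k ∈ Finset.range n, C n k
  have hM0 : ∀ n, 0 ≤ M n := fun n => Finset.sum_nonneg fun k _ => hC0 n k
  let lam : ℕ → ℝ := fun n => 1 + 4 ^ n * |a n| * (M n + 1)
  have hlam : ∀ n, 1 ≤ lam n := fun n => by
    have := hM0 n
    have : 0 ≤ 4 ^ n * |a n| * (M n + 1) := by positivity
    simp only [lam]; linarith
  have hlam0 : ∀ n, 0 < lam n := fun n => one_pos.trans_le (hlam n)
  have hlamM : ∀ n, |a n| * M n ≤ (1 / 2) ^ n * lam n := fun n => by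
    have h1 := hM0 n
    have h2 := abs_nonneg (a n)
    have h3 : (1 / 2 : ℝ) ^ n * 4 ^ n = 2 ^ n := by rw [← mul_pow]; norm_num
    have h4 : (1 : ℝ) ≤ 2 ^ n := one_le_pow₀ one_le_two
    have h5 : (1 / 2 : ℝ) ^ n * lam n = (1 / 2) ^ n + 2 ^ n * (|a n| * (M n + 1)) := by
      rw [← h3]; ring
    rw [h5]
    have h6 : (0 : ℝ) ≤ (1 / 2) ^ n := by positivity
    have h7 : 0 ≤ |a n| * (M n + 1) := by positivity
    nlinarith
  have hlam2 : ∀ n, |a n| * 2 ^ n ≤ (1 / 2) ^ n * lam n := fun n => by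
    have h1 := hM0 n
    have h2 := abs_nonneg (a n)
    have h3 : (1 / 2 : ℝ) ^ n * 4 ^ n = 2 ^ n := by rw [← mul_pow]; norm_num
    have h5 : (1 / 2 : ℝ) ^ n * lam n = (1 / 2) ^ n + 2 ^ n * (|a n| * (M n + 1)) := by
      rw [← h3]; ring
    rw [h5]
    have h6 : (0 : ℝ) ≤ (1 / 2) ^ n := by positivity
    have h7 : 0 ≤ 2 ^ n * (|a n| * M n) := by positivity
    nlinarith
  let F : ℕ → ℝ → ℝ := fun n x => a n * (lam n)⁻¹ ^ n * h n (lam n * x)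
  have hF : ∀ n x, F n x = a n * x ^ n * χ (lam n * x) := fun n x => by
    have := (hlam0 n).ne'
    simp only [F, h, mul_pow, inv_pow]
    field_simp
  have hFs : ∀ n, ContDiff ℝ ∞ (F n) := fun n =>
    contDiff_const.mul ((hh n).comp (contDiff_const.mul contDiff_id))
  have hsum : Summable fun n : ℕ => (1 / 2 : ℝ) ^ n := summable_geometric_two
  -- the bound of the `n`-th term, off its first few derivatives
  have hFb : ∀ N : ℕ, ∀ n, N < n → ∀ x : ℝ, |F n x| ≤ |x| ^ N * (1 / 2) ^ n := fun N n hn x => by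
    rw [hF]
    by_cases hx : |lam n * x| < 2
    · have hχ : |χ (lam n * x)| ≤ 1 := by
        rw [abs_of_nonneg χ.nonneg]; exact χ.le_one
      rw [abs_mul, hlam0 n |>.le |> abs_of_nonneg] at hx
      obtain ⟨k, rfl⟩ : ∃ k, n = N + (k + 1) := ⟨n - N - 1, by omega⟩
      set L := lam (N + (k + 1)) with hL
      have hL1 := hlam (N + (k + 1))
      have hL0 := hlam0 (N + (k + 1))
      rw [← hL] at hL1 hL0
      have hx1 : |x| ≤ 2 := by nlinarith [abs_nonneg x]
      have h2 : |x| ^ (k + 1) * L ≤ 2 ^ (N + (k + 1)) := by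
        calc |x| ^ (k + 1) * L = |x| ^ k * (L * |x|) := by ring
          _ ≤ 2 ^ k * 2 := by gcongr
          _ = 2 ^ (k + 1) := by ring
          _ ≤ 2 ^ (N + (k + 1)) := pow_le_pow_right₀ one_le_two (by omega)
      have h3 : |a (N + (k + 1))| * |x| ^ (k + 1) ≤ (1 / 2) ^ (N + (k + 1)) := by
        have h4 := hlam2 (N + (k + 1))
        rw [← hL] at h4
        have h5 : (|a (N + (k + 1))| * |x| ^ (k + 1)) * L ≤ (1 / 2) ^ (N + (k + 1)) * L := by
          rw [mul_assoc]
          exact (mul_le_mul_of_nonneg_left h2 (abs_nonneg _)).trans h4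
        exact le_of_mul_le_mul_right h5 hL0
      rw [abs_mul, abs_mul, abs_pow, pow_add]
      calc |a (N + (k + 1))| * (|x| ^ N * |x| ^ (k + 1)) * |χ (L * x)|
          ≤ |a (N + (k + 1))| * (|x| ^ N * |x| ^ (k + 1)) * 1 := by gcongr
        _ = |x| ^ N * (|a (N + (k + 1))| * |x| ^ (k + 1)) := by ring
        _ ≤ _ := by gcongr
    · have : χ (lam n * x) = 0 := χ.zero_of_le_dist (by
        rw [Real.dist_eq, sub_zero]; exact not_lt.1 hx)
      rw [this]; simp
  have hsF : ∀ x, Summable fun n => F n x := fun x => by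
    refine (summable_nat_add_iff 1).1 (.of_norm_bounded ((summable_nat_add_iff 1).2 hsum)
      fun n => ?_)
    simpa using hFb 0 (n + 1) (by omega) x
  refine ⟨fun x => ∑' n, F n x, ?_, fun N => ?_⟩
  · refine contDiff_tsum_of_eventually (v := fun _ n => (1 / 2) ^ n) hFs (fun _ _ => hsum)
      fun k _ => ?_
    rw [Nat.cofinite_eq_atTop]
    filter_upwards [eventually_gt_atTop k] with n hn x
    rw [norm_iteratedFDeriv_eq_norm_iteratedDeriv]
    have h1 : iteratedDeriv k (F n) x
        = a n * (lam n)⁻¹ ^ n * (lam n ^ k * iteratedDeriv k (h n) (lam n * x)) := by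
      have e1 : F n = fun x => (a n * (lam n)⁻¹ ^ n) * (fun y => h n (lam n * y)) x := rfl
      rw [e1, iteratedDeriv_const_mul_field, iteratedDeriv_comp_const_mul
        ((hh n).of_le (by exact_mod_cast le_top))]
    have h2 : ‖iteratedDeriv k (h n) (lam n * x)‖ ≤ M n :=
      (hC n k _).trans (Finset.single_le_sum (f := fun k => C n k) (fun k _ => hC0 n k)
        (Finset.mem_range.2 hn))
    have h3 : (lam n)⁻¹ ^ n * lam n ^ k ≤ (lam n)⁻¹ := by
      obtain ⟨j, rfl⟩ : ∃ j, n = k + 1 + j := ⟨n - k - 1, by omega⟩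
      set L := lam (k + 1 + j)
      have hL0 : 0 < L := hlam0 _
      have hL1 : L⁻¹ ≤ 1 := inv_le_one_of_one_le₀ (hlam _)
      have : L⁻¹ ^ (k + 1 + j) * L ^ k = L⁻¹ * L⁻¹ ^ j := by
        rw [pow_add, pow_add, inv_pow L k]; field_simp
      rw [this]
      exact mul_le_of_le_one_right (by positivity) (pow_le_one₀ (by positivity) hL1)
    have h4 : (lam n)⁻¹ ^ n * lam n ^ k * (|a n| * M n) ≤ (1 / 2) ^ n := by
      calc (lam n)⁻¹ ^ n * lam n ^ k * (|a n| * M n)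
          ≤ (lam n)⁻¹ * ((1 / 2) ^ n * lam n) := by
            have := hlam0 n
            have := hM0 n
            exact mul_le_mul h3 (hlamM n) (by positivity) (by positivity)
        _ = (1 / 2) ^ n := by
            have := (hlam0 n).ne'
            field_simp
    rw [h1]
    simp only [norm_mul, norm_pow, norm_inv]
    rw [Real.norm_of_nonneg (hlam0 n).le, Real.norm_eq_abs (a n)]
    have := hlam0 n
    calc |a n| * (lam n)⁻¹ ^ n * (lam n ^ k * ‖iteratedDeriv k (h n) (lam n * x)‖)
        ≤ |a n| * (lam n)⁻¹ ^ n * (lam n ^ k * M n) := by gcongr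
      _ = (lam n)⁻¹ ^ n * lam n ^ k * (|a n| * M n) := by ring
      _ ≤ _ := h4
  · have hev : ∀ n, ∀ᶠ x : ℝ in 𝓝 0, F n x = a n * x ^ n := fun n => by
      have h1 : ∀ᶠ x : ℝ in 𝓝 0, |lam n * x| < 1 := by
        have : ContinuousAt (fun x : ℝ => |lam n * x|) 0 := by fun_prop
        exact this.eventually_lt continuousAt_const (by simp)
      filter_upwards [h1] with x hx
      rw [hF, χ.one_of_mem_closedBall, mul_one]
      simpa [Real.dist_eq] using hx.le
    have hev' : ∀ᶠ x : ℝ in 𝓝 0, ∀ n ∈ Finset.range (N + 1), F n x = a n * x ^ n :=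
      (Finset.eventually_all (Finset.range (N + 1))).2 fun n _ => hev n
    have hbig : (fun x => (∑' n, F n x) - ∑ n ∈ Finset.range (N + 1), a n * x ^ n)
        =O[𝓝 0] fun x : ℝ => x ^ N := by
      refine Asymptotics.IsBigO.of_bound (∑' n : ℕ, (1 / 2 : ℝ) ^ (n + (N + 1))) ?_
      filter_upwards [hev'] with x hx
      have e : (∑' n, F n x) - ∑ n ∈ Finset.range (N + 1), a n * x ^ n
          = ∑' n, F (n + (N + 1)) x := by
        rw [← (hsF x).sum_add_tsum_nat_add (N + 1), Finset.sum_congr rfl hx]; ring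
      rw [e, mul_comm, norm_pow, ← tsum_mul_left]
      exact tsum_of_norm_bounded
        (((summable_nat_add_iff (N + 1)).2 hsum).mul_left _).hasSum
        fun n => hFb N (n + (N + 1)) (by omega) x
    have hN : (fun x : ℝ => a N * x ^ N) =O[𝓝 0] fun x : ℝ => x ^ N :=
      (Asymptotics.isBigO_refl _ _).const_mul_left _
    refine (hbig.add hN).congr_left fun x => ?_
    rw [Finset.sum_range_succ]; ring

/-! ### Flat functions, even functions and smooth extension -/

/-- A function which is infinitely flat at the origin: a smooth multiple of every power of the
variable. -/
def IsFlat (R : ℝ → ℝ) : Prop := ∀ N : ℕ, ∃ g : ℝ → ℝ, ContDiff ℝ ∞ g ∧ ∀ x, R x = x ^ N * g x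

theorem IsFlat.contDiff {R : ℝ → ℝ} (hR : IsFlat R) : ContDiff ℝ ∞ R := by
  obtain ⟨g, hg, h⟩ := hR 0
  rwa [show R = g from funext fun x => by simp [h]]

theorem IsFlat.eq_zero {R : ℝ → ℝ} (hR : IsFlat R) : R 0 = 0 := by
  obtain ⟨g, -, h⟩ := hR 1
  simp [h]

theorem IsFlat.exists_eq_mul {R : ℝ → ℝ} (hR : IsFlat R) : ∃ S, IsFlat S ∧ ∀ x, R x = x * S x := by
  obtain ⟨S, hS, h⟩ := hR 1
  refine ⟨S, fun N => ?_, fun x => by simp [h]⟩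
  obtain ⟨g, hg, hg'⟩ := hR (N + 1)
  refine ⟨g, hg, fun x => ?_⟩
  -- both sides are continuous and agree off the origin
  refine congrFun (Continuous.ext_on (dense_compl_singleton (0 : ℝ)) hS.continuous
    ((continuous_pow N).mul hg.continuous) fun y hy => ?_) x
  have : y * S y = y * (y ^ N * g y) := by
    rw [← mul_assoc, ← pow_succ', ← hg', h, pow_one]
  exact mul_left_cancel₀ hy this

theorem IsFlat.exists_eq_pow_mul {R : ℝ → ℝ} (hR : IsFlat R) (k : ℕ) :
    ∃ S, IsFlat S ∧ ∀ x, R x = x ^ k * S x := by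
  induction k with
  | zero => exact ⟨R, hR, by simp⟩
  | succ k ih =>
    obtain ⟨S, hS, h⟩ := ih
    obtain ⟨T, hT, h'⟩ := hS.exists_eq_mul
    exact ⟨T, hT, fun x => by rw [h, h', pow_succ]; ring⟩

theorem IsFlat.deriv {R : ℝ → ℝ} (hR : IsFlat R) : IsFlat (deriv R) := fun N => by
  obtain ⟨g, hg, h⟩ := hR (N + 1)
  refine ⟨fun x => (N + 1) * g x + x * _root_.deriv g x, ?_, fun x => ?_⟩
  · exact (contDiff_const.mul hg).add (contDiff_id.mul (contDiff_infty_iff_deriv.1 hg).2)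
  · rw [show R = fun x => x ^ (N + 1) * g x from funext h]
    have h1 : HasDerivAt g (_root_.deriv g x) x :=
      (hg.differentiable (by simp)).differentiableAt.hasDerivAt
    rw [((hasDerivAt_pow (N + 1) x).fun_mul h1).deriv]
    push_cast
    ring

theorem IsFlat.const_mul {R : ℝ → ℝ} (hR : IsFlat R) (c : ℝ) :
    IsFlat fun x => c * R x := fun N => by
  obtain ⟨g, hg, h⟩ := hR N
  exact ⟨fun x => c * g x, contDiff_const.mul hg, fun x => by beta_reduce; rw [h]; ring⟩

theorem isFlat_of_isBigO {R : ℝ → ℝ} (hR : ContDiff ℝ ∞ R)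
    (h : ∀ N : ℕ, R =O[𝓝 0] fun x : ℝ => x ^ N) : IsFlat R := fun N =>
  exists_eq_pow_mul_of_isBigO hR N ((h N).mono nhdsWithin_le_nhds)

/-- A flat function stays smooth when it is composed with a `p`-th root `ρ`: the derivative of
`R ∘ ρ` is again a flat function composed with `ρ`. -/
theorem IsFlat.contDiff_comp_root {p : ℕ} (hp : p ≠ 0) {ρ : ℝ → ℝ} (hc : Continuous ρ)
    (h0 : ρ 0 = 0) (hb : ∀ x, |ρ x| ^ p ≤ |x|)
    (hd : ∀ x, x ≠ 0 → ρ =ᶠ[𝓝 x] 0 ∨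
      (ρ x ≠ 0 ∧ HasDerivAt ρ ((p * ρ x ^ (p - 1))⁻¹) x))
    {R : ℝ → ℝ} (hR : IsFlat R) : ContDiff ℝ ∞ fun x => R (ρ x) := by
  have key : ∀ R : ℝ → ℝ, IsFlat R → ∃ S, IsFlat S ∧
      ∀ x, HasDerivAt (fun x => R (ρ x)) (S (ρ x)) x := fun R hR => by
    obtain ⟨S, hS, h⟩ := hR.deriv.exists_eq_pow_mul (p - 1)
    refine ⟨fun x => (p : ℝ)⁻¹ * S x, hS.const_mul _, fun x => ?_⟩
    by_cases hx : x = 0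
    · subst hx
      beta_reduce
      rw [h0, hS.eq_zero, mul_zero, hasDerivAt_iff_isLittleO]
      obtain ⟨T, hT, h'⟩ := hR.exists_eq_pow_mul p
      simp only [h0, hR.eq_zero, sub_zero, smul_zero]
      have h1 : Tendsto (fun x => T (ρ x)) (𝓝 0) (𝓝 0) :=
        (hT.contDiff.continuous.comp hc).tendsto' _ _ (by simp [h0, hT.eq_zero])
      have h2 : (fun x => ρ x ^ p) =O[𝓝 0] fun x => x :=
        .of_bound 1 (Eventually.of_forall fun x => by simpa using hb x)
      simpa [h'] using h2.mul_isLittleO ((Asymptotics.isLittleO_one_iff ℝ).2 h1)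
    · rcases hd x hx with h1 | ⟨h1, h2⟩
      · have e : (fun x => R (ρ x)) =ᶠ[𝓝 x] fun _ => 0 := by
          filter_upwards [h1] with y hy
          simp [hy, hR.eq_zero]
        rw [h1.eq_of_nhds]
        simp only [Pi.zero_apply, hS.eq_zero, mul_zero]
        exact (hasDerivAt_const x (0 : ℝ)).congr_of_eventuallyEq e
      · have h3 : HasDerivAt R (_root_.deriv R (ρ x)) (ρ x) :=
          (hR.contDiff.differentiable (by simp)).differentiableAt.hasDerivAt
        refine (h3.comp x h2).congr_deriv ?_
        have h4 : ρ x ^ (p - 1) ≠ 0 := pow_ne_zero _ h1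
        have h5 : (p : ℝ) ≠ 0 := by exact_mod_cast hp
        rw [h]; field_simp
  rw [contDiff_infty]
  intro n
  induction n generalizing R with
  | zero => exact contDiff_zero.2 (hR.contDiff.continuous.comp hc)
  | succ n ih =>
    obtain ⟨S, hS, h⟩ := key R hR
    push_cast
    rw [contDiff_succ_iff_deriv]
    refine ⟨fun x => (h x).differentiableAt, by simp, ?_⟩
    rw [funext fun x => (h x).deriv]
    exact ih hS

theorem sum_range_mul_eq (f : ℕ → ℝ) (p N : ℕ) :
    ∑ m ∈ Finset.range (p * N), f m
      = ∑ r ∈ Finset.range p, ∑ n ∈ Finset.range N, f (p * n + r) := by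
  induction N with
  | zero => simp
  | succ N ih =>
    simp only [Finset.sum_range_succ, Finset.sum_add_distrib]
    rw [mul_add, mul_one, Finset.sum_range_add, ih]

/-- Up to a flat function, a smooth function is a combination of `1, v, …, v ^ (p - 1)` with
coefficients that are smooth functions of `v ^ p`. -/
theorem exists_isFlat_sub_sum {h : ℝ → ℝ} (hh : ContDiff ℝ ∞ h) {p : ℕ} (hp : p ≠ 0) :
    ∃ A : ℕ → ℝ → ℝ, (∀ r, ContDiff ℝ ∞ (A r)) ∧
      IsFlat fun v => h v - ∑ r ∈ Finset.range p, v ^ r * A r (v ^ p) := by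
  obtain ⟨c, hc⟩ := exists_taylor hh
  choose A hA hA' using fun r => exists_contDiff_taylor fun n => c (p * n + r)
  refine ⟨A, hA, isFlat_of_isBigO ?_ fun N => ?_⟩
  · exact hh.sub (ContDiff.sum fun r _ => (contDiff_id.pow r).mul ((hA r).comp (contDiff_id.pow p)))
  · have h1 : (fun v => h v - ∑ m ∈ Finset.range (p * N), c m * v ^ m)
        =O[𝓝 0] fun v : ℝ => v ^ (p * N) := by
      obtain ⟨g, hg, hg'⟩ := hc (p * N)
      have : g =O[𝓝 0] fun _ => (1 : ℝ) := (hg.continuous.continuousAt (x := 0)).isBigO_one ℝ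
      simpa [hg'] using (Asymptotics.isBigO_refl (fun v : ℝ => v ^ (p * N)) (𝓝 0)).mul this
    have h2 : ∀ r, (fun v : ℝ => v ^ r * (A r (v ^ p) -
        ∑ n ∈ Finset.range N, c (p * n + r) * (v ^ p) ^ n)) =O[𝓝 0] fun v : ℝ => v ^ (p * N) := by
      intro r
      have ht : Tendsto (fun v : ℝ => v ^ p) (𝓝 0) (𝓝 0) :=
        (continuous_pow p).tendsto' _ _ (by simp [hp])
      have h3 := (hA' r N).comp_tendsto ht
      have h4 : (fun v : ℝ => v ^ r) =O[𝓝 0] fun _ => (1 : ℝ) :=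
        ((continuous_pow r).continuousAt (x := 0)).isBigO_one ℝ
      simpa [Function.comp_def, pow_mul] using h4.mul h3
    have h3 := h1.sub (Asymptotics.IsBigO.fun_sum (s := Finset.range p) fun r _ => h2 r)
    refine Asymptotics.IsBigO.trans (h3.congr_left fun v => ?_) ?_
    · rw [sum_range_mul_eq, sub_sub, ← Finset.sum_add_distrib]
      congr 1
      refine Finset.sum_congr rfl fun r _ => ?_
      rw [mul_sub, Finset.mul_sum]
      rw [show (∑ n ∈ Finset.range N, c (p * n + r) * v ^ (p * n + r))
        = ∑ n ∈ Finset.range N, v ^ r * (c (p * n + r) * (v ^ p) ^ n) from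
        Finset.sum_congr rfl fun n _ => by rw [pow_add, pow_mul]; ring]
      ring
    · obtain ⟨k, hk⟩ : ∃ k, p * N = N + k := ⟨p * N - N, by
        have := Nat.le_mul_of_pos_left N (Nat.pos_of_ne_zero hp); omega⟩
      rw [hk]
      simp only [pow_add]
      have h4 : (fun v : ℝ => v ^ k) =O[𝓝 0] fun _ => (1 : ℝ) :=
        ((continuous_pow k).continuousAt (x := 0)).isBigO_one ℝ
      simpa using (Asymptotics.isBigO_refl (fun v : ℝ => v ^ N) (𝓝 0)).mul h4

/-- Whitney's theorem on even functions. After subtraction of the two Borel series only a flat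
function is left, whose even and odd parts remain smooth when `v` is replaced by a square root. -/
theorem exists_even_odd_decomposition {h : ℝ → ℝ} (hh : ContDiff ℝ ∞ h) :
    ∃ A B : ℝ → ℝ, ContDiff ℝ ∞ A ∧ ContDiff ℝ ∞ B ∧ ∀ v, h v = A (v ^ 2) + v * B (v ^ 2) := by
  obtain ⟨A, hA, hR⟩ := exists_isFlat_sub_sum hh two_ne_zero
  simp only [Finset.sum_range_succ, Finset.range_zero, Finset.sum_empty, pow_zero, one_mul,
    zero_add, pow_one] at hR
  set R := fun v => h v - (A 0 (v ^ 2) + v * A 1 (v ^ 2)) with hRdef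
  have hneg : IsFlat fun v => R (-v) := fun N => by
    obtain ⟨g, hg, hg'⟩ := hR N
    exact ⟨fun v => (-1) ^ N * g (-v), contDiff_const.mul (hg.comp contDiff_neg), fun v => by
      beta_reduce; rw [hg', neg_pow]; ring⟩
  have hadd : ∀ c : ℝ, IsFlat fun v => (1 / 2) * (R v + c * R (-v)) := fun c N => by
    obtain ⟨g, hg, hg'⟩ := hR N
    obtain ⟨k, hk, hk'⟩ := hneg N
    exact ⟨fun v => (1 / 2) * (g v + c * k v), contDiff_const.mul (hg.add (contDiff_const.mul hk)),
      fun v => by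
        have h1 := hk' v
        beta_reduce at h1 ⊢
        rw [hg', h1]; ring⟩
  have hsmooth : ∀ S : ℝ → ℝ, IsFlat S → ContDiff ℝ ∞ fun x => S √x := fun S hS => by
    refine hS.contDiff_comp_root two_ne_zero Real.continuous_sqrt Real.sqrt_zero (fun x => ?_)
      fun x hx => ?_
    · rcases le_total 0 x with hx | hx
      · rw [sq_abs, Real.sq_sqrt hx]; exact le_abs_self x
      · simp [Real.sqrt_eq_zero_of_nonpos hx]
    · rcases hx.lt_or_gt with hx | hx
      · left
        filter_upwards [eventually_lt_nhds hx] with y hy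
        exact Real.sqrt_eq_zero_of_nonpos hy.le
      · right
        refine ⟨(Real.sqrt_pos.2 hx).ne', (Real.hasDerivAt_sqrt hx.ne').congr_deriv ?_⟩
        norm_num
  obtain ⟨S, hS, hS'⟩ := (hadd (-1)).exists_eq_mul
  refine ⟨fun x => A 0 x + (1 / 2) * (R √x + 1 * R (-√x)), fun x => A 1 x + S √x,
    (hA 0).add (hsmooth _ (hadd 1)), (hA 1).add (hsmooth _ hS), fun v => ?_⟩
  have e : h v = R v + (A 0 (v ^ 2) + v * A 1 (v ^ 2)) := by simp [hRdef]
  rw [e]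
  simp only [Real.sqrt_sq_eq_abs]
  have h1 := hS' v
  have h2 := hS' (-v)
  rw [neg_neg] at h2
  rcases abs_choice v with h | h <;> rw [h]
  · linarith
  · rw [neg_neg]; linarith

/-- The analogue for cubes of the decomposition into even and odd parts. The flat remainder is
itself a smooth function of `v ^ 3` and is added to the first coefficient. -/
theorem exists_mod_three_decomposition {h : ℝ → ℝ} (hh : ContDiff ℝ ∞ h) :
    ∃ A B C : ℝ → ℝ, ContDiff ℝ ∞ A ∧ ContDiff ℝ ∞ B ∧ ContDiff ℝ ∞ C ∧
      ∀ v, h v = A (v ^ 3) + v * B (v ^ 3) + v ^ 2 * C (v ^ 3) := by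
  obtain ⟨A, hA, hR⟩ := exists_isFlat_sub_sum hh three_ne_zero
  simp only [Finset.sum_range_succ, Finset.range_zero, Finset.sum_empty, pow_zero, one_mul,
    zero_add, pow_one] at hR
  have hodd : Odd 3 := by decide
  have hsurj : Function.Surjective fun x : ℝ => x ^ 3 :=
    (continuous_pow 3).surjective (tendsto_pow_atTop three_ne_zero)
      ((tendsto_neg_atTop_atBot.comp ((tendsto_pow_atTop three_ne_zero).comp
        tendsto_neg_atBot_atTop)).congr fun x : ℝ => by simp [hodd.neg_pow])
  let e := hodd.strictMono_pow.orderIsoOfSurjective _ hsurj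
  have he : ∀ x, e x = x ^ 3 := fun x => rfl
  have he' : ∀ x, (e.symm x) ^ 3 = x := fun x => by rw [← he]; exact e.apply_symm_apply x
  have hs := hR.contDiff_comp_root (ρ := e.symm) three_ne_zero e.symm.continuous
    (by rw [e.symm_apply_eq, he]; norm_num) (fun x => by rw [← abs_pow, he']) fun x hx => by
      have h0 : e.symm x ≠ 0 := fun h => hx (by rw [← he' x, h]; norm_num)
      refine .inr ⟨h0, ?_⟩
      refine HasDerivAt.of_local_left_inverse (f := fun x : ℝ => x ^ 3)
        e.symm.continuous.continuousAt (by simpa using hasDerivAt_pow 3 (e.symm x)) (by simp [h0])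
        (Eventually.of_forall he')
  refine ⟨_, A 1, A 2, (hA 0).add hs, hA 1, hA 2, fun v => ?_⟩
  have : e.symm (v ^ 3) = v := e.symm_apply_apply v
  rw [this]; ring

/-- A function that is smooth near a point agrees near it with a globally smooth one. -/
theorem exists_contDiff_eventuallyEq {E : Type*} [NormedAddCommGroup E] [NormedSpace ℝ E]
    [FiniteDimensional ℝ E] {f : E → ℝ} {U : Set E} {a : E} (hf : ContDiffOn ℝ ∞ f U)
    (hU : U ∈ 𝓝 a) : ∃ g : E → ℝ, ContDiff ℝ ∞ g ∧ g =ᶠ[𝓝 a] f := by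
  obtain ⟨r, hr, hrU⟩ := Metric.mem_nhds_iff.1 hU
  let χ : ContDiffBump a := ⟨r / 3, r / 2, by positivity, by linarith⟩
  refine ⟨fun x => χ x * f x, contDiff_iff_contDiffAt.2 fun x => ?_, ?_⟩
  · by_cases hx : x ∈ Metric.ball a r
    · exact χ.contDiff.contDiffAt.mul
        ((hf.mono hrU).contDiffAt (Metric.isOpen_ball.mem_nhds hx))
    · have h1 : x ∈ (Metric.closedBall a (r / 2))ᶜ := fun h => hx
        (Metric.closedBall_subset_ball (by linarith) h)
      refine (contDiffAt_const (c := (0 : ℝ))).congr_of_eventuallyEq ?_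
      filter_upwards [Metric.isClosed_closedBall.isOpen_compl.mem_nhds h1] with y hy
      rw [χ.zero_of_le_dist (not_le.1 fun h => hy (Metric.mem_closedBall.2 h)).le, zero_mul]
  · filter_upwards [χ.eventuallyEq_one] with x hx
    simp [hx]

theorem Set.OrdConnected.uniqueDiffOn {I : Set ℝ} (hI : I.OrdConnected) (hI' : I.Nontrivial) :
    UniqueDiffOn ℝ I :=
  uniqueDiffOn_convex hI.convex (hI.convex.nontrivial_iff_nonempty_interior.1 hI')

/-- The value at `t` of a function that is smooth on `[0, δ]` is a smooth function of `t`: for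
`f (v ^ 2)` is an even function of `v`, and even functions are smooth functions of `v ^ 2`. -/
theorem exists_contDiff_eqOn_right {f : ℝ → ℝ} {δ : ℝ} (hδ : 0 < δ)
    (hf : ContDiffOn ℝ ∞ f (Icc 0 δ)) :
    ∃ g : ℝ → ℝ, ContDiff ℝ ∞ g ∧ ∀ᶠ t in 𝓝[≥] 0, f t = g t := by
  have hU : (fun v : ℝ => v ^ 2) ⁻¹' Iio δ ∈ 𝓝 (0 : ℝ) :=
    (isOpen_Iio.preimage (continuous_pow 2)).mem_nhds (by simpa)
  have hs : ContDiffOn ℝ ∞ (fun v : ℝ => f (v ^ 2)) ((fun v : ℝ => v ^ 2) ⁻¹' Iio δ) :=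
    hf.comp (contDiff_id.pow 2).contDiffOn fun v hv => ⟨sq_nonneg v, le_of_lt hv⟩
  obtain ⟨h, hh, he⟩ := exists_contDiff_eventuallyEq hs hU
  obtain ⟨A, B, hA, hB, hAB⟩ := exists_even_odd_decomposition hh
  have hneg : Tendsto (fun v : ℝ => -v) (𝓝 0) (𝓝 0) := continuous_neg.tendsto' _ _ neg_zero
  have hev : ∀ᶠ v : ℝ in 𝓝 0, f (v ^ 2) = A (v ^ 2) := by
    filter_upwards [he, hneg.eventually he] with v h1 h2
    have h3 := hAB v
    have h4 := hAB (-v)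
    simp only [neg_sq] at h2 h4
    linarith
  have hsq : Tendsto Real.sqrt (𝓝[≥] 0) (𝓝 0) :=
    (Real.continuous_sqrt.tendsto' 0 0 Real.sqrt_zero).mono_left nhdsWithin_le_nhds
  refine ⟨A, hA, ?_⟩
  filter_upwards [hsq.eventually hev, self_mem_nhdsWithin] with t ht ht0
  rwa [Real.sq_sqrt ht0] at ht

/-- A function which is smooth along an interval `I` has near each point of `I`, be it an endpoint,
a smooth extension to the line. -/
theorem exists_contDiff_eventuallyEq_nhdsWithin {I : Set ℝ} (hI : I.OrdConnected)
    (hI' : I.Nontrivial) {f : ℝ → ℝ} (hf : ContDiffOn ℝ ∞ f I) {t₀ : ℝ} (ht₀ : t₀ ∈ I) :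
    ∃ g : ℝ → ℝ, ContDiff ℝ ∞ g ∧ f =ᶠ[𝓝[I] t₀] g := by
  have hcomp : ∀ (c : ℝ) (δ : ℝ), 0 < δ → (∀ u ∈ Icc 0 δ, t₀ + c * u ∈ I) →
      ∃ g : ℝ → ℝ, ContDiff ℝ ∞ g ∧ ∀ᶠ u in 𝓝[≥] 0, f (t₀ + c * u) = g u := fun c δ hδ h =>
    exists_contDiff_eqOn_right hδ (hf.comp (contDiff_const.add
      (contDiff_const.mul contDiff_id)).contDiffOn h)
  have hback : ∀ c : ℝ, c * c = 1 → (∀ t ∈ I, 0 ≤ c * (t - t₀)) →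
      ∀ g : ℝ → ℝ, (∀ᶠ u in 𝓝[≥] 0, f (t₀ + c * u) = g u) →
      ∀ᶠ t in 𝓝[I] t₀, f t = g (c * (t - t₀)) := fun c hc h g hg => by
    have ht : Tendsto (fun t => c * (t - t₀)) (𝓝[I] t₀) (𝓝[≥] 0) := by
      refine tendsto_nhdsWithin_iff.2 ⟨?_, eventually_nhdsWithin_of_forall h⟩
      exact (Continuous.tendsto' (by fun_prop) _ _ (by simp)).mono_left nhdsWithin_le_nhds
    filter_upwards [ht.eventually hg] with t h1
    rw [← h1]
    congr 1
    linear_combination -(t - t₀) * hc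
  by_cases hl : ∃ a ∈ I, a < t₀
  · by_cases hr : ∃ b ∈ I, t₀ < b
    · obtain ⟨a, ha, hat⟩ := hl
      obtain ⟨b, hb, htb⟩ := hr
      obtain ⟨g, hg, he⟩ := exists_contDiff_eventuallyEq (hf.mono (hI.out ha hb))
        (Icc_mem_nhds hat htb)
      exact ⟨g, hg, he.symm.filter_mono nhdsWithin_le_nhds⟩
    · obtain ⟨a, ha, hat⟩ := hl
      push Not at hr
      obtain ⟨g, hg, he⟩ := hcomp (-1) (t₀ - a) (by linarith) fun u hu =>
        hI.out ha ht₀ ⟨by linarith [hu.2], by linarith [hu.1]⟩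
      exact ⟨fun t => g (-1 * (t - t₀)), hg.comp (contDiff_const.mul (contDiff_id.sub
        contDiff_const)), hback (-1) (by norm_num) (fun t ht => by linarith [hr t ht]) g he⟩
  · push Not at hl
    obtain ⟨b, hb, hbt⟩ := hI'.exists_ne t₀
    have htb : t₀ < b := lt_of_le_of_ne (hl b hb) hbt.symm
    obtain ⟨g, hg, he⟩ := hcomp 1 (b - t₀) (by linarith) fun u hu =>
      hI.out ht₀ hb ⟨by linarith [hu.1], by linarith [hu.2]⟩
    exact ⟨fun t => g (1 * (t - t₀)), hg.comp (contDiff_const.mul (contDiff_id.sub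
      contDiff_const)), hback 1 (by norm_num) (fun t ht => by linarith [hl t ht]) g he⟩

/-! ### Leading terms along an interval -/

/-- Along `I`, near `t₀`, the function `f` is `(t - t₀) ^ n` times a smooth function whose value
at `t₀` is `l`. The coefficient `l` may vanish. -/
def HasLeadingTerm (I : Set ℝ) (t₀ : ℝ) (n : ℕ) (l : ℝ) (f : ℝ → ℝ) : Prop :=
  ∃ F : ℝ → ℝ, ContDiff ℝ ∞ F ∧ F t₀ = l ∧ ∀ᶠ t in 𝓝[I] t₀, f t = (t - t₀) ^ n * F t

namespace HasLeadingTerm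

variable {I : Set ℝ} {t₀ : ℝ} {n m : ℕ} {l l' : ℝ} {f g : ℝ → ℝ}

theorem congr (h : HasLeadingTerm I t₀ n l f) (hfg : f =ᶠ[𝓝[I] t₀] g) :
    HasLeadingTerm I t₀ n l g := by
  obtain ⟨F, hF, hl, he⟩ := h
  exact ⟨F, hF, hl, by filter_upwards [he, hfg] with t h1 h2; rw [← h2, h1]⟩

theorem congr_coeff (h : HasLeadingTerm I t₀ n l f) (hl : l = l') : HasLeadingTerm I t₀ n l' f :=
  hl ▸ h

theorem mul (hf : HasLeadingTerm I t₀ n l f) (hg : HasLeadingTerm I t₀ m l' g) :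
    HasLeadingTerm I t₀ (n + m) (l * l') fun t => f t * g t := by
  obtain ⟨F, hF, hl, he⟩ := hf
  obtain ⟨G, hG, hl', he'⟩ := hg
  refine ⟨fun t => F t * G t, hF.mul hG, by simp only [hl, hl'], ?_⟩
  filter_upwards [he, he'] with t h1 h2
  rw [h1, h2]; ring

theorem add (hf : HasLeadingTerm I t₀ n l f) (hg : HasLeadingTerm I t₀ n l' g) :
    HasLeadingTerm I t₀ n (l + l') fun t => f t + g t := by
  obtain ⟨F, hF, hl, he⟩ := hf
  obtain ⟨G, hG, hl', he'⟩ := hg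
  refine ⟨fun t => F t + G t, hF.add hG, by simp only [hl, hl'], ?_⟩
  filter_upwards [he, he'] with t h1 h2
  rw [h1, h2]; ring

theorem const_mul (hf : HasLeadingTerm I t₀ n l f) (c : ℝ) :
    HasLeadingTerm I t₀ n (c * l) fun t => c * f t := by
  obtain ⟨F, hF, hl, he⟩ := hf
  refine ⟨fun t => c * F t, contDiff_const.mul hF, by simp only [hl], ?_⟩
  filter_upwards [he] with t h1
  rw [h1]; ring

theorem sub (hf : HasLeadingTerm I t₀ n l f) (hg : HasLeadingTerm I t₀ n l' g) :
    HasLeadingTerm I t₀ n (l - l') fun t => f t - g t :=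
  ((hf.add (hg.const_mul (-1))).congr_coeff (by ring)).congr
    (Eventually.of_forall fun t => by ring)

theorem pow (hf : HasLeadingTerm I t₀ n l f) (k : ℕ) :
    HasLeadingTerm I t₀ (n * k) (l ^ k) fun t => f t ^ k := by
  obtain ⟨F, hF, hl, he⟩ := hf
  refine ⟨fun t => F t ^ k, hF.pow k, by simp only [hl], ?_⟩
  filter_upwards [he] with t h1
  rw [h1, mul_pow, pow_mul]

theorem of_contDiffOn (hI : I.OrdConnected) (hI' : I.Nontrivial) (ht₀ : t₀ ∈ I)
    (hf : ContDiffOn ℝ ∞ f I) : HasLeadingTerm I t₀ 0 (f t₀) f := by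
  obtain ⟨F, hF, he⟩ := exists_contDiff_eventuallyEq_nhdsWithin hI hI' hf ht₀
  exact ⟨F, hF, (he.eq_of_nhdsWithin ht₀).symm, he.mono fun t ht => by simpa using ht⟩

theorem of_add (h : HasLeadingTerm I t₀ (n + m) l f) (hm : m ≠ 0) : HasLeadingTerm I t₀ n 0 f := by
  obtain ⟨F, hF, -, he⟩ := h
  refine ⟨fun t => (t - t₀) ^ m * F t, ((contDiff_id.sub contDiff_const).pow m).mul hF,
    by simp [hm], ?_⟩
  filter_upwards [he] with t h1
  rw [h1]; ring

/-- A vanishing leading coefficient raises the order, by Hadamard's lemma. -/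
theorem exists_succ (h : HasLeadingTerm I t₀ n 0 f) : ∃ l, HasLeadingTerm I t₀ (n + 1) l f := by
  obtain ⟨F, hF, hl, he⟩ := h
  obtain ⟨G, hG, hFG⟩ := exists_eq_add_sub_mul hF t₀
  refine ⟨G t₀, G, hG, rfl, ?_⟩
  filter_upwards [he] with t h1
  rw [h1, hFG, hl]; ring

theorem apply_eq (h : HasLeadingTerm I t₀ 0 l f) (ht₀ : t₀ ∈ I) : f t₀ = l := by
  obtain ⟨F, -, hl, he⟩ := h
  simpa [hl] using he.self_of_nhdsWithin ht₀

theorem apply_eq_zero (h : HasLeadingTerm I t₀ n l f) (hn : n ≠ 0) (ht₀ : t₀ ∈ I) : f t₀ = 0 := by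
  obtain ⟨F, -, -, he⟩ := h
  simpa [hn] using he.self_of_nhdsWithin ht₀

theorem tendsto (h : HasLeadingTerm I t₀ n l f) :
    Tendsto (fun t => f t / (t - t₀) ^ n) (𝓝[I \ {t₀}] t₀) (𝓝 l) := by
  obtain ⟨F, hF, hl, he⟩ := h
  refine Tendsto.congr' ?_ (hl ▸ hF.continuous.continuousAt.tendsto.mono_left nhdsWithin_le_nhds)
  filter_upwards [he.filter_mono (nhdsWithin_mono _ sdiff_subset), self_mem_nhdsWithin] with t h1 h2
  have : (t - t₀) ^ n ≠ 0 := pow_ne_zero _ (sub_ne_zero.2 h2.2)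
  rw [h1]; field_simp

theorem unique (hacc : AccPt t₀ (𝓟 I)) (h : HasLeadingTerm I t₀ n l f)
    (h' : HasLeadingTerm I t₀ n l' f) : l = l' :=
  have : (𝓝[I \ {t₀}] t₀).NeBot := accPt_principal_iff_nhdsWithin.1 hacc
  tendsto_nhds_unique h.tendsto h'.tendsto

/-- The leading coefficient of a smooth function can be computed as a limit. -/
theorem of_tendsto (hacc : AccPt t₀ (𝓟 I)) (h : HasLeadingTerm I t₀ 0 l' f)
    (hf : Tendsto (fun t => f t / (t - t₀) ^ n) (𝓝[I \ {t₀}] t₀) (𝓝 l)) :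
    HasLeadingTerm I t₀ n l f := by
  have : (𝓝[I \ {t₀}] t₀).NeBot := accPt_principal_iff_nhdsWithin.1 hacc
  have key : ∀ m ≤ n, ∃ c, HasLeadingTerm I t₀ m c f := fun m => by
    induction m with
    | zero => exact fun _ => ⟨l', h⟩
    | succ m ih =>
      intro hm
      obtain ⟨c, hc⟩ := ih (by omega)
      obtain ⟨k, rfl⟩ : ∃ k, n = m + (k + 1) := ⟨n - m - 1, by omega⟩
      have h1 : Tendsto (fun t => (t - t₀) ^ (k + 1)) (𝓝[I \ {t₀}] t₀) (𝓝 0) :=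
        (Continuous.tendsto' (by fun_prop) _ _ (by simp)).mono_left nhdsWithin_le_nhds
      have h2 := hf.mul h1
      rw [mul_zero] at h2
      have h3 : c = 0 := tendsto_nhds_unique hc.tendsto (h2.congr' (by
        filter_upwards [self_mem_nhdsWithin] with t ht
        have : t - t₀ ≠ 0 := sub_ne_zero.2 ht.2
        rw [pow_add]
        field_simp))
      exact (h3 ▸ hc).exists_succ
  obtain ⟨c, hc⟩ := key n le_rfl
  exact tendsto_nhds_unique hc.tendsto hf ▸ hc

/-- Division of leading terms. -/
theorem of_mul (hacc : AccPt t₀ (𝓟 I)) {a : ℝ} (hf : HasLeadingTerm I t₀ 0 a f)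
    (hg : HasLeadingTerm I t₀ m l' g) (hl' : l' ≠ 0)
    (hfg : HasLeadingTerm I t₀ (n + m) l fun t => f t * g t) :
    HasLeadingTerm I t₀ n (l / l') f := by
  refine of_tendsto hacc hf ((hfg.tendsto.div hg.tendsto hl').congr' ?_)
  filter_upwards [self_mem_nhdsWithin, hg.tendsto.eventually_ne hl'] with t ht hgt
  have h1 : t - t₀ ≠ 0 := sub_ne_zero.2 ht.2
  have h2 : g t ≠ 0 := fun h => hgt (by simp [h])
  simp only [Pi.div_apply, pow_add]
  field_simp

/-- Differentiation of leading terms. -/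
theorem hasDerivWithinAt (h : HasLeadingTerm I t₀ (n + 1) l f) {f' : ℝ → ℝ}
    (hI : UniqueDiffOn ℝ I) (hf : ∀ t ∈ I, HasDerivWithinAt f (f' t) I t) :
    HasLeadingTerm I t₀ n ((n + 1) * l) f' := by
  obtain ⟨F, hF, hl, he⟩ := h
  refine ⟨fun t => (n + 1) * F t + (t - t₀) * deriv F t, (contDiff_const.mul hF).add
    ((contDiff_id.sub contDiff_const).mul (contDiff_infty_iff_deriv.1 hF).2), by simp [hl], ?_⟩
  filter_upwards [eventually_eventually_nhdsWithin.2 he, self_mem_nhdsWithin] with t h1 ht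
  have h2 : HasDerivAt F (deriv F t) t :=
    (hF.differentiable (by simp)).differentiableAt.hasDerivAt
  have h3 := ((((hasDerivAt_id t).sub_const t₀).fun_pow (n + 1)).fun_mul h2).hasDerivWithinAt
    (s := I)
  have h4 := h3.congr_of_eventuallyEq h1 (h1.self_of_nhdsWithin ht)
  rw [(hI t ht).eq_deriv _ (hf t ht) h4]
  push_cast
  simp only [id]
  ring

/-- Integration of leading terms. -/
theorem of_hasDerivWithinAt (hacc : AccPt t₀ (𝓟 I)) {a : ℝ} {f' : ℝ → ℝ}
    (hI : UniqueDiffOn ℝ I) (hf : ∀ t ∈ I, HasDerivWithinAt f (f' t) I t) (ht₀ : t₀ ∈ I)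
    (h0 : f t₀ = 0) (h : HasLeadingTerm I t₀ 0 a f) (h' : HasLeadingTerm I t₀ n l f') :
    HasLeadingTerm I t₀ (n + 1) (l / (n + 1)) f := by
  have key : ∀ m ≤ n, ∃ c, HasLeadingTerm I t₀ (m + 1) c f := fun m => by
    induction m with
    | zero =>
      have : a = 0 := by rw [← h.apply_eq ht₀, h0]
      exact fun _ => (this ▸ h).exists_succ
    | succ m ih =>
      intro hm
      obtain ⟨c, hc⟩ := ih (by omega)
      obtain ⟨k, rfl⟩ : ∃ k, n = m + (k + 1) := ⟨n - m - 1, by omega⟩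
      have h1 := (hc.hasDerivWithinAt hI hf).unique hacc (h'.of_add (by omega))
      have h2 : c = 0 := by
        have : (m : ℝ) + 1 ≠ 0 := by positivity
        simpa [this] using h1
      exact (h2 ▸ hc).exists_succ
  obtain ⟨c, hc⟩ := key n le_rfl
  have h1 := (hc.hasDerivWithinAt hI hf).unique hacc h'
  refine hc.congr_coeff ?_
  have : (n : ℝ) + 1 ≠ 0 := by positivity
  rw [← h1]; field_simp

end HasLeadingTerm

/-! ### Germs of diffeomorphisms and normal forms of plane cusps -/

section DiffeoGerm

variable {E F G : Type*} [NormedAddCommGroup E] [NormedSpace ℝ E]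
  [NormedAddCommGroup F] [NormedSpace ℝ F] [NormedAddCommGroup G] [NormedSpace ℝ G]
  {S : Set E} {T : Set F} {W : Set G} {a : E} {b : F} {c : G}

theorem IsDiffeoGerm.comp {Φ : E → F} {Θ : F → G} (hΘ : IsDiffeoGerm T b W c Θ)
    (hΦ : IsDiffeoGerm S a T b Φ) : IsDiffeoGerm S a W c (Θ ∘ Φ) := by
  obtain ⟨Ψ, U, V, hU, hV, ha, hb, hab, hΦs, hΨs, hm, hm', hl, hr⟩ := hΦ
  obtain ⟨Ψ', U', V', hU', hV', ha', hb', hab', hΦs', hΨs', hn, hn', hl', hr'⟩ := hΘ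
  refine ⟨Ψ ∘ Ψ', U ∩ Φ ⁻¹' U', V' ∩ Ψ' ⁻¹' V, hΦs.continuousOn.isOpen_inter_preimage hU hU',
    hΨs'.continuousOn.isOpen_inter_preimage hV' hV, ⟨⟨ha.1, by simpa [hab] using ha'.1⟩, ha.2⟩,
    ⟨⟨hb'.1, ?_⟩, hb'.2⟩, by simp [hab, hab'], hΦs'.comp (hΦs.mono inter_subset_left)
      fun x hx => hx.2, hΨs.comp (hΨs'.mono inter_subset_left) fun x hx => hx.2, ?_, ?_, ?_, ?_⟩
  · have := hl' ha'
    rw [hab'] at this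
    simpa [this] using hb.1
  · rintro x ⟨⟨hx, hx'⟩, hxS⟩
    have h1 := hm ⟨hx, hxS⟩
    have h2 := hn ⟨hx', h1.2⟩
    exact ⟨⟨h2.1, by simpa [hl' ⟨hx', h1.2⟩] using h1.1⟩, h2.2⟩
  · rintro x ⟨⟨hx, hx'⟩, hxS⟩
    have h1 := hn' ⟨hx, hxS⟩
    have h2 := hm' ⟨hx', h1.2⟩
    exact ⟨⟨h2.1, by simpa [hr ⟨hx', h1.2⟩] using h1.1⟩, h2.2⟩
  · rintro x ⟨⟨hx, hx'⟩, hxS⟩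
    have h1 := hm ⟨hx, hxS⟩
    simp only [Function.comp_apply, hl' ⟨hx', h1.2⟩, hl ⟨hx, hxS⟩]
  · rintro x ⟨⟨hx, hx'⟩, hxS⟩
    have h1 := hn' ⟨hx, hxS⟩
    simp only [Function.comp_apply, hr ⟨hx', h1.2⟩, hr' ⟨hx, hxS⟩]

theorem IsDiffeoGerm.exists_inverse {Φ : E → F} (hΦ : IsDiffeoGerm S a T b Φ) :
    ∃ Ψ, IsDiffeoGerm T b S a Ψ ∧ (∀ᶠ x in 𝓝[S] a, Ψ (Φ x) = x) ∧
      ∀ᶠ y in 𝓝[T] b, Φ (Ψ y) = y := by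
  obtain ⟨Ψ, U, V, hU, hV, ha, hb, hab, hΦs, hΨs, hm, hm', hl, hr⟩ := hΦ
  refine ⟨Ψ, ⟨Φ, V, U, hV, hU, hb, ha, hab ▸ hl ha, hΨs, hΦs, hm', hm, hr, hl⟩, ?_, ?_⟩
  · filter_upwards [mem_nhdsWithin_of_mem_nhds (hU.mem_nhds ha.1), self_mem_nhdsWithin]
      with x h1 h2 using hl ⟨h1, h2⟩
  · filter_upwards [mem_nhdsWithin_of_mem_nhds (hV.mem_nhds hb.1), self_mem_nhdsWithin]
      with x h1 h2 using hr ⟨h1, h2⟩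

theorem IsDiffeoGerm.exists_contDiffOn {Φ : E → F} (hΦ : IsDiffeoGerm S a T b Φ) :
    ∃ U ∈ 𝓝 a, ContDiffOn ℝ ∞ Φ U := by
  obtain ⟨Ψ, U, V, hU, hV, ha, hb, hab, hΦs, -⟩ := hΦ
  exact ⟨U, hU.mem_nhds ha.1, hΦs⟩

theorem IsDiffeoGerm.contDiffAt {Φ : E → F} (hΦ : IsDiffeoGerm S a T b Φ) :
    ContDiffAt ℝ ∞ Φ a := by
  obtain ⟨U, hU, h⟩ := hΦ.exists_contDiffOn
  exact h.contDiffAt hU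

theorem IsDiffeoGerm.apply_eq {Φ : E → F} (hΦ : IsDiffeoGerm S a T b Φ) : Φ a = b := by
  obtain ⟨Ψ, U, V, hU, hV, ha, hb, hab, -⟩ := hΦ
  exact hab

theorem IsDiffeoGerm.tendsto {Φ : E → F} (hΦ : IsDiffeoGerm S a T b Φ) :
    Tendsto Φ (𝓝 a) (𝓝 b) := by
  simpa [ContinuousAt, hΦ.apply_eq] using hΦ.contDiffAt.continuousAt

theorem IsDiffeoGerm.injective_fderiv {Φ : E → F} (hΦ : IsDiffeoGerm univ a univ b Φ) :
    Function.Injective (fderiv ℝ Φ a) := by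
  obtain ⟨Ψ, hΨ, h, -⟩ := hΦ.exists_inverse
  have h1 := hΦ.contDiffAt.differentiableAt (by simp)
  have h2 := hΨ.contDiffAt.differentiableAt (by simp)
  rw [← hΦ.apply_eq] at h2
  have h3 : Ψ ∘ Φ =ᶠ[𝓝 a] id := by rwa [nhdsWithin_univ] at h
  have h4 := h3.fderiv_eq (𝕜 := ℝ)
  rw [fderiv_comp a h2 h1, fderiv_id] at h4
  intro x y hxy
  have h5 := congrArg (fun L : E →L[ℝ] E => L x) h4
  have h6 := congrArg (fun L : E →L[ℝ] E => L y) h4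
  simp only [ContinuousLinearMap.comp_apply, ContinuousLinearMap.id_apply, hxy] at h5 h6
  rw [← h5, h6]

/-- The inverse function theorem, for germs. -/
theorem isDiffeoGerm_of_injective_fderiv [FiniteDimensional ℝ E] {f : E → E} {b : E}
    (hf : ContDiff ℝ ∞ f) (hinj : Function.Injective (fderiv ℝ f a)) (hb : f a = b) :
    IsDiffeoGerm (univ : Set E) a univ b f := by
  subst hb
  have : CompleteSpace E := FiniteDimensional.complete ℝ E
  let L : E ≃L[ℝ] E :=
    (LinearEquiv.ofInjectiveEndo (fderiv ℝ f a).toLinearMap hinj).toContinuousLinearEquiv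
  have hL : (L : E →L[ℝ] E) = fderiv ℝ f a := by ext x; rfl
  have hfd : HasFDerivAt f (L : E →L[ℝ] E) a := by
    rw [hL]; exact (hf.differentiable (by simp)).differentiableAt.hasFDerivAt
  let e := hf.contDiffAt.toOpenPartialHomeomorph f hfd (by simp)
  have he : ∀ x, e x = f x := fun x => rfl
  have hae : a ∈ e.source := hf.contDiffAt.mem_toOpenPartialHomeomorph_source hfd (by simp)
  have hopen : IsOpen (fderiv ℝ f ⁻¹' range ((↑) : (E ≃L[ℝ] E) → E →L[ℝ] E)) :=
    ContinuousLinearEquiv.isOpen.preimage (hf.continuous_fderiv (by simp))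
  set D := fderiv ℝ f ⁻¹' range ((↑) : (E ≃L[ℝ] E) → E →L[ℝ] E) with hD
  refine ⟨e.symm, e.source ∩ D, e.target ∩ e.symm ⁻¹' D, e.open_source.inter hopen,
    e.isOpen_inter_preimage_symm hopen, ⟨⟨hae, ⟨L, hL⟩⟩, mem_univ _⟩,
    ⟨⟨e.map_source hae, ?_⟩, mem_univ _⟩, rfl, hf.contDiffOn, ?_, ?_, ?_, ?_, ?_⟩
  · rw [mem_preimage, ← he, e.left_inv hae]; exact ⟨L, hL⟩
  · rintro y ⟨hy, ⟨M, hM⟩⟩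
    refine ContDiffAt.contDiffWithinAt (e.contDiffAt_symm (f₀' := M) hy ?_ hf.contDiffAt)
    rw [hM]
    exact (hf.differentiable (by simp)).differentiableAt.hasFDerivAt
  · rintro x ⟨⟨hx, hx'⟩, -⟩
    refine ⟨⟨e.map_source hx, ?_⟩, mem_univ _⟩
    rw [mem_preimage, ← he, e.left_inv hx]; exact hx'
  · rintro y ⟨⟨hy, hy'⟩, -⟩
    exact ⟨⟨e.map_target hy, hy'⟩, mem_univ _⟩
  · rintro x ⟨⟨hx, hx'⟩, -⟩
    exact e.left_inv hx
  · rintro y ⟨⟨hy, hy'⟩, -⟩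
    exact e.right_inv hy

end DiffeoGerm

theorem isDiffeoGerm_of_deriv_ne_zero {f : ℝ → ℝ} (hf : ContDiff ℝ ∞ f) {a b f' : ℝ}
    (h : HasDerivAt f f' a) (hf' : f' ≠ 0) (hb : f a = b) : IsDiffeoGerm univ a univ b f := by
  refine isDiffeoGerm_of_injective_fderiv hf ?_ hb
  rw [h.hasFDerivAt.fderiv]
  intro x y hxy
  simpa [hf'] using hxy

/-- The hypotheses on `g` say that its derivative at the origin in the second variable is not zero.
-/
theorem isDiffeoGerm_prodMk_fst {g : ℝ × ℝ → ℝ} (hg : ContDiff ℝ ∞ g) (hg0 : g 0 = 0) {d : ℝ}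
    (h : HasDerivAt (fun y => g (0, y)) d 0) (hd : d ≠ 0) :
    IsDiffeoGerm (univ : Set (ℝ × ℝ)) 0 univ 0 fun x => (x.1, g x) := by
  refine isDiffeoGerm_of_injective_fderiv (contDiff_fst.prodMk hg) ?_ (by simp [hg0])
  have h1 : HasFDerivAt g (fderiv ℝ g 0) ((0 : ℝ), (0 : ℝ)) :=
    (hg.differentiable (by simp)).differentiableAt.hasFDerivAt
  have h2 : fderiv ℝ g 0 (0, 1) = d :=
    (h1.comp_hasDerivAt (0 : ℝ) ((hasDerivAt_const (0 : ℝ) (0 : ℝ)).prodMk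
      (hasDerivAt_id (0 : ℝ)))).unique h
  have h3 : HasFDerivAt (fun x : ℝ × ℝ => (x.1, g x))
      ((ContinuousLinearMap.fst ℝ ℝ ℝ).prod (fderiv ℝ g 0)) 0 := hasFDerivAt_fst.prodMk h1
  rw [h3.fderiv, injective_iff_map_eq_zero]
  rintro ⟨u, v⟩ huv
  simp only [ContinuousLinearMap.prod_apply, ContinuousLinearMap.coe_fst', Prod.mk_eq_zero] at huv
  obtain ⟨rfl, hv⟩ := huv
  have h4 : fderiv ℝ g 0 (0, v) = v * d := by
    rw [← h2, show ((0 : ℝ), v) = v • ((0 : ℝ), (1 : ℝ)) by simp, map_smul, smul_eq_mul]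
  rw [h4] at hv
  simp [hd] at hv
  simp [hv]

/-- The germ at the origin of the plane curve `p` is `𝒜`-equivalent to that of
`u ↦ (u ^ i, u ^ j)`. -/
def IsPlaneCusp (i j : ℕ) (p : ℝ → ℝ × ℝ) : Prop :=
  ∃ (φ : ℝ → ℝ) (F : ℝ × ℝ → ℝ × ℝ), IsDiffeoGerm univ 0 univ 0 φ ∧
    IsDiffeoGerm univ 0 univ 0 F ∧ ∀ᶠ t in 𝓝 0, p t = F (φ t ^ i, φ t ^ j)

namespace IsPlaneCusp

variable {i j : ℕ} {p q : ℝ → ℝ × ℝ}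

theorem congr (hp : IsPlaneCusp i j p) (hpq : p =ᶠ[𝓝 0] q) : IsPlaneCusp i j q := by
  obtain ⟨φ, F, hφ, hF, he⟩ := hp
  exact ⟨φ, F, hφ, hF, by filter_upwards [he, hpq] with t h1 h2; rw [← h2, h1]⟩

theorem comp_left (hp : IsPlaneCusp i j p) {T : ℝ × ℝ → ℝ × ℝ}
    (hT : IsDiffeoGerm univ 0 univ 0 T) : IsPlaneCusp i j (T ∘ p) := by
  obtain ⟨φ, F, hφ, hF, he⟩ := hp
  exact ⟨φ, T ∘ F, hφ, hT.comp hF, by filter_upwards [he] with t h1; simp [h1]⟩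

theorem comp_right (hp : IsPlaneCusp i j p) {ψ : ℝ → ℝ}
    (hψ : IsDiffeoGerm univ 0 univ 0 ψ) : IsPlaneCusp i j (p ∘ ψ) := by
  obtain ⟨φ, F, hφ, hF, he⟩ := hp
  exact ⟨φ ∘ ψ, F, hφ.comp hψ, hF, hψ.tendsto.eventually he⟩

/-- The map `(X, Y) ↦ (X, g (X, Y))` takes the monomial curve to this one, and is a local
diffeomorphism. -/
theorem of_graph {g : ℝ × ℝ → ℝ} (hg : ContDiff ℝ ∞ g) (hg0 : g 0 = 0) {d : ℝ}
    (h : HasDerivAt (fun y => g (0, y)) d 0) (hd : d ≠ 0) :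
    IsPlaneCusp i j fun v => (v ^ i, g (v ^ i, v ^ j)) :=
  ⟨id, _, isDiffeoGerm_of_deriv_ne_zero contDiff_id (hasDerivAt_id _) one_ne_zero rfl,
    isDiffeoGerm_prodMk_fst hg hg0 h hd, Eventually.of_forall fun _ => rfl⟩

end IsPlaneCusp

theorem exists_contDiff_mul_eventuallyEq {f g : ℝ → ℝ} (hf : ContDiff ℝ ∞ f)
    (hg : ContDiff ℝ ∞ g) (hg0 : g 0 ≠ 0) :
    ∃ q : ℝ → ℝ, ContDiff ℝ ∞ q ∧ ∀ᶠ x in 𝓝 0, q x * g x = f x := by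
  have hU : {x | g x ≠ 0} ∈ 𝓝 (0 : ℝ) := hg.continuous.continuousAt.eventually_ne hg0
  obtain ⟨q, hq, he⟩ := exists_contDiff_eventuallyEq
    (hf.contDiffOn.div hg.contDiffOn fun x hx => hx) hU
  refine ⟨q, hq, ?_⟩
  filter_upwards [he, hU] with x h1 h2
  rw [h1]
  exact div_mul_cancel₀ _ h2

theorem exists_contDiff_pow_eventuallyEq {X : ℝ → ℝ} (hX : ContDiff ℝ ∞ X) (hX0 : X 0 = 1)
    {i : ℕ} (hi : i ≠ 0) :
    ∃ V : ℝ → ℝ, ContDiff ℝ ∞ V ∧ V 0 = 1 ∧ ∀ᶠ x in 𝓝 0, V x ^ i = X x := by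
  have hU : {x | 0 < X x} ∈ 𝓝 (0 : ℝ) :=
    continuousAt_const.eventually_lt hX.continuous.continuousAt (by simp [hX0])
  obtain ⟨V, hV, he⟩ := exists_contDiff_eventuallyEq (f := fun x => X x ^ ((i : ℝ)⁻¹))
    (hX.contDiffOn.rpow_const_of_ne fun x (hx : 0 < X x) => hx.ne') hU
  refine ⟨V, hV, by rw [he.eq_of_nhds]; simp [hX0], ?_⟩
  filter_upwards [he, hU] with x h1 h2
  rw [h1]
  exact Real.rpow_inv_natCast_pow (le_of_lt h2) hi

/-- Taking `ψ` inverse to the parameter `u * V u`, in which the first component of the curve is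
`u ^ i`. -/
theorem IsPlaneCusp.of_reparametrization {i j : ℕ} {X Z V D : ℝ → ℝ} (hV : ContDiff ℝ ∞ V)
    (hV0 : V 0 = 1) (hVX : ∀ᶠ x in 𝓝 0, V x ^ i = X x) (hD : ∀ᶠ x in 𝓝 0, D x * V x ^ j = Z x)
    (h : ∀ ψ : ℝ → ℝ, ContDiff ℝ ∞ ψ → ψ 0 = 0 → (∀ᶠ r in 𝓝 0, ψ r * V (ψ r) = r) →
      IsPlaneCusp i j fun r => (r ^ i, r ^ j * D (ψ r))) :
    IsPlaneCusp i j fun t => (t ^ i * X t, t ^ j * Z t) := by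
  have hφ : IsDiffeoGerm univ 0 univ 0 fun t => t * V t := by
    have h1 : HasDerivAt V (deriv V 0) 0 :=
      (hV.differentiable (by simp)).differentiableAt.hasDerivAt
    refine isDiffeoGerm_of_deriv_ne_zero (contDiff_id.mul hV) ((hasDerivAt_id (0 : ℝ)).fun_mul h1)
      ?_ (by simp)
    simp [hV0]
  obtain ⟨ψ', hψ', hl, hr⟩ := hφ.exists_inverse
  rw [nhdsWithin_univ] at hl hr
  obtain ⟨U, hU, hs⟩ := hψ'.exists_contDiffOn
  obtain ⟨ψ, hψ, he⟩ := exists_contDiff_eventuallyEq hs hU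
  have hψ0 : ψ 0 = 0 := by rw [he.eq_of_nhds, hψ'.apply_eq]
  have hr' : ∀ᶠ r in 𝓝 0, ψ r * V (ψ r) = r := by
    filter_upwards [hr, he] with r h1 h2
    rw [h2, h1]
  refine ((h ψ hψ hψ0 hr').comp_right hφ).congr ?_
  filter_upwards [hl, hφ.tendsto.eventually he, hVX, hD] with t h1 h2 h3 h4
  simp only [Function.comp_apply, h2, h1, mul_pow, h3, ← h4]
  rw [mul_assoc, mul_comm (V t ^ j)]

/-- With `h v = A (v ^ 2) + v * B (v ^ 2)` the curve is the image of `(X, Y) = (v ^ 2, v ^ (2 * k +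
1))` under `(X, Y) ↦ (X, Y * A X + X ^ (k + 1) * B X)`. -/
theorem isPlaneCusp_two_of_monomial {k : ℕ} {h : ℝ → ℝ} (hh : ContDiff ℝ ∞ h)
    (h0 : h 0 ≠ 0) :
    IsPlaneCusp 2 (2 * k + 1) fun v => (v ^ 2, v ^ (2 * k + 1) * h v) := by
  obtain ⟨A, B, hA, hB, hAB⟩ := exists_even_odd_decomposition hh
  refine (IsPlaneCusp.of_graph (d := A 0)
    (g := fun x => x.2 * A x.1 + x.1 ^ (k + 1) * B x.1) ?_ ?_ ?_ ?_).congr ?_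
  · exact (contDiff_snd.mul (hA.comp contDiff_fst)).add
      ((contDiff_fst.pow _).mul (hB.comp contDiff_fst))
  · simp
  · simpa using (hasDerivAt_id (0 : ℝ)).mul_const (A 0)
  · simpa [hAB] using h0
  · refine Eventually.of_forall fun v => ?_
    simp only [hAB, Prod.mk.injEq, true_and]
    ring

/-- All the exponents in `d * v ^ 4 + v ^ 6 * h v` lie in the semigroup generated by `3` and `4`,
once `h` is decomposed according to the residues modulo `3`. -/
theorem isPlaneCusp_three_four_of_monomial {h : ℝ → ℝ} (hh : ContDiff ℝ ∞ h) {d : ℝ}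
    (hd : d ≠ 0) : IsPlaneCusp 3 4 fun v => (v ^ 3, v ^ 4 * (d + v ^ 2 * h v)) := by
  obtain ⟨A, B, C, hA, hB, hC, hABC⟩ := exists_mod_three_decomposition hh
  refine (IsPlaneCusp.of_graph (d := d)
    (g := fun x => d * x.2 + x.1 ^ 2 * A x.1 + x.1 * x.2 * B x.1 + x.2 ^ 2 * C x.1)
    ?_ ?_ ?_ hd).congr ?_
  · have := hA.comp (contDiff_fst (𝕜 := ℝ) (E := ℝ) (F := ℝ))
    have := hB.comp (contDiff_fst (𝕜 := ℝ) (E := ℝ) (F := ℝ))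
    have := hC.comp (contDiff_fst (𝕜 := ℝ) (E := ℝ) (F := ℝ))
    simp only [Function.comp_def] at *
    fun_prop
  · simp
  · have h1 := ((hasDerivAt_id (0 : ℝ)).const_mul d).fun_add
      ((hasDerivAt_pow 2 (0 : ℝ)).mul_const (C 0))
    simpa using h1
  · refine Eventually.of_forall fun v => ?_
    simp only [hABC, Prod.mk.injEq, true_and]
    ring

/-- The exponents in `d * v ^ 5 + e * v ^ 6 + v ^ 8 * h v` lie in the semigroup generated by `3`
and `5`; the gap `7` is avoided. -/
theorem isPlaneCusp_three_five_of_monomial {h : ℝ → ℝ} (hh : ContDiff ℝ ∞ h) {d : ℝ}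
    (hd : d ≠ 0) (e : ℝ) :
    IsPlaneCusp 3 5 fun v => (v ^ 3, v ^ 5 * (d + e * v + v ^ 3 * h v)) := by
  obtain ⟨A, B, C, hA, hB, hC, hABC⟩ := exists_mod_three_decomposition hh
  refine (IsPlaneCusp.of_graph (d := d)
    (g := fun x => d * x.2 + e * x.1 ^ 2 + x.1 * x.2 * A x.1 + x.1 ^ 3 * B x.1 + x.2 ^ 2 * C x.1)
    ?_ ?_ ?_ hd).congr ?_
  · have := hA.comp (contDiff_fst (𝕜 := ℝ) (E := ℝ) (F := ℝ))
    have := hB.comp (contDiff_fst (𝕜 := ℝ) (E := ℝ) (F := ℝ))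
    have := hC.comp (contDiff_fst (𝕜 := ℝ) (E := ℝ) (F := ℝ))
    simp only [Function.comp_def] at *
    fun_prop
  · simp
  · have h1 := ((hasDerivAt_id (0 : ℝ)).const_mul d).fun_add
      ((hasDerivAt_pow 2 (0 : ℝ)).mul_const (C 0))
    simpa using h1
  · refine Eventually.of_forall fun v => ?_
    simp only [hABC, Prod.mk.injEq, true_and]
    ring

/-- The first component of `(x + c z, z)`, with `x = u ^ 3` and `z = u ^ (3 + d) * Z u`, is the cube
of `u * V u`. In this parameter the coefficient of order `d` of the second factor of `z` is that of
`Z` less a multiple of `c`, so that a suitable `c` gives it any chosen value. -/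
theorem exists_shear_root {Z : ℝ → ℝ} (hZ : ContDiff ℝ ∞ Z) (hZ0 : Z 0 ≠ 0) {d j : ℕ} (hd : d ≠ 0)
    (hj : j ≠ 0) (e : ℝ) :
    ∃ (c : ℝ) (V W E : ℝ → ℝ), ContDiff ℝ ∞ V ∧ ContDiff ℝ ∞ W ∧ ContDiff ℝ ∞ E ∧ V 0 = 1 ∧
      E 0 = e ∧ (∀ᶠ u in 𝓝 0, V u ^ 3 = 1 + c * u ^ d * Z u) ∧
      (∀ᶠ u in 𝓝 0, V u = 1 + u ^ d * W u) ∧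
      ∀ᶠ u in 𝓝 0, (Z u - u ^ d * E u) * V u ^ j = Z u := by
  have hj' : (j : ℝ) ≠ 0 := by exact_mod_cast hj
  set c : ℝ := 3 * e / (j * Z 0 ^ 2) with hc
  obtain ⟨V, hV, hV0, hVX⟩ := exists_contDiff_pow_eventuallyEq
    (X := fun u => 1 + c * u ^ d * Z u) (by fun_prop) (by simp [hd]) three_ne_zero
  obtain ⟨W, hW, hW'⟩ := exists_contDiff_mul_eventuallyEq (f := fun u => c * Z u)
    (g := fun u => V u ^ 2 + V u + 1) (by fun_prop) (by fun_prop) (by norm_num [hV0])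
  obtain ⟨E, hE, hE'⟩ := exists_contDiff_mul_eventuallyEq
    (f := fun u => Z u * W u * ∑ i ∈ Finset.range j, V u ^ i) (g := fun u => V u ^ j)
    (by fun_prop) (by fun_prop) (by simp [hV0])
  have hVW : ∀ᶠ u in 𝓝 0, V u = 1 + u ^ d * W u := by
    have : ∀ᶠ u in 𝓝 0, V u ^ 2 + V u + 1 ≠ 0 := ContinuousAt.eventually_ne
      (by have := hV.continuous; fun_prop) (by norm_num [hV0])
    filter_upwards [hVX, hW', this] with u h1 h2 h3
    refine mul_right_cancel₀ h3 ?_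
    linear_combination h1 - u ^ d * h2
  refine ⟨c, V, W, E, hV, hW, hE, hV0, ?_, hVX, hVW, ?_⟩
  · have h1 := hE'.self_of_nhds
    have h2 := hW'.self_of_nhds
    simp only [hV0, one_pow, mul_one, Finset.sum_const, Finset.card_range, nsmul_eq_mul] at h1 h2
    rw [h1, show W 0 = c * Z 0 / 3 by linarith, hc]
    field_simp
  · filter_upwards [hVW, hE'] with u h1 h2
    have h3 := mul_geom_sum (V u) j
    linear_combination (-u ^ d) * h2 - Z u * h3 + Z u * (∑ i ∈ Finset.range j, V u ^ i) * h1

theorem isDiffeoGerm_linear {a b d : ℝ} (ha : a ≠ 0) (hd : d ≠ 0) :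
    IsDiffeoGerm (univ : Set (ℝ × ℝ)) 0 univ 0 fun x => (a * x.1 + b * x.2, d * x.2) := by
  refine isDiffeoGerm_of_injective_fderiv (by fun_prop) ?_ (by simp)
  have h : HasFDerivAt (fun x : ℝ × ℝ => (a * x.1 + b * x.2, d * x.2))
      ((a • ContinuousLinearMap.fst ℝ ℝ ℝ + b • ContinuousLinearMap.snd ℝ ℝ ℝ).prod
        (d • ContinuousLinearMap.snd ℝ ℝ ℝ)) 0 :=
    ((hasFDerivAt_fst.const_mul a).add (hasFDerivAt_snd.const_mul b)).prodMk
      (hasFDerivAt_snd.const_mul d)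
  rw [h.fderiv, injective_iff_map_eq_zero]
  rintro ⟨u, v⟩ huv
  simp [hd] at huv
  obtain ⟨h1, rfl⟩ := huv
  simpa [ha] using h1

/-- The one term whose exponent, `5` for `d = 1` and `7` for `d = 2`, is a gap of the semigroup
generated by `3` and `3 + d` is removed by adding a multiple of the second component to the first
and taking the cube root of the sum as the new parameter. -/
theorem isPlaneCusp_three_of_cube {d : ℕ} (hd : d = 1 ∨ d = 2) {Z : ℝ → ℝ} (hZ : ContDiff ℝ ∞ Z)
    (hZ0 : Z 0 ≠ 0) : IsPlaneCusp 3 (3 + d) fun u => (u ^ 3, u ^ (3 + d) * Z u) := by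
  have hd0 : d ≠ 0 := by omega
  obtain ⟨Y, hY, hZY⟩ := exists_eq_add_sub_mul hZ 0
  obtain ⟨Y', hY', hYY'⟩ := exists_eq_add_sub_mul hY 0
  simp only [sub_zero] at hZY hYY'
  -- the coefficient of order `d` of `Z`
  obtain ⟨c, V, W, E, hV, hW, hE, hV0, hE0, hVX, hVW, hD⟩ :=
    exists_shear_root hZ hZ0 hd0 (j := 3 + d) (by omega) (if d = 1 then Y 0 else Y' 0)
  have key : IsPlaneCusp 3 (3 + d)
      fun u => (u ^ 3 * (1 + c * u ^ d * Z u), u ^ (3 + d) * Z u) := by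
    refine IsPlaneCusp.of_reparametrization hV hV0 hVX hD fun ψ hψ hψ0 hψV => ?_
    obtain ⟨U, hU, hψU⟩ := exists_eq_add_sub_mul hψ 0
    simp only [sub_zero, hψ0, zero_add] at hψU
    have hψt : Tendsto ψ (𝓝 0) (𝓝 0) := hψ.continuous.tendsto' _ _ hψ0
    rcases hd with rfl | rfl
    · obtain ⟨K, hK, hK'⟩ := exists_eq_add_sub_mul (hY.sub hE) 0
      simp only [if_pos, hE0, sub_zero, sub_self, zero_add] at hK'
      refine (isPlaneCusp_three_four_of_monomial (h := fun r => U r ^ 2 * K (ψ r))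
        (by fun_prop) hZ0).congr (Eventually.of_forall fun r => ?_)
      have h1 := hK' (ψ r)
      simp only [Prod.mk.injEq, true_and]
      rw [hZY (ψ r), hψU]
      rw [hψU] at h1
      linear_combination (-r ^ 4 * (r * U r)) * h1
    · obtain ⟨K, hK, hK'⟩ := exists_eq_add_sub_mul (hY'.sub hE) 0
      simp only [OfNat.ofNat_ne_one, if_false, hE0, sub_zero, sub_self, zero_add] at hK'
      refine (isPlaneCusp_three_five_of_monomial
        (h := fun r => U r ^ 3 * K (ψ r) - Y 0 * (U r ^ 3 * W (ψ r)))
        (by fun_prop) hZ0 (Y 0)).congr ?_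
      filter_upwards [hψV, hψt.eventually hVW] with r h2 h3
      have h1 := hK' (ψ r)
      simp only [Prod.mk.injEq, true_and]
      rw [hZY (ψ r), hYY' (ψ r)]
      rw [h3] at h2
      have h4 := hψU r
      generalize ψ r = u at *
      subst h4
      linear_combination (-r ^ 5 * (r * U r) ^ 2) * h1 - Y 0 * r ^ 5 * h2
  refine (key.comp_left (isDiffeoGerm_linear (b := -c) one_ne_zero one_ne_zero)).congr
    (Eventually.of_forall fun u => ?_)
  simp only [Function.comp_apply, Prod.mk.injEq, one_mul, and_true]
  ring

/-- A plane curve whose components have orders exactly `i` and `j` is, for the four pairs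
considered, equivalent to the monomial curve. -/
theorem isPlaneCusp_of_order {i j : ℕ}
    (hij : (i = 2 ∧ (j = 3 ∨ j = 5)) ∨ (i = 3 ∧ (j = 4 ∨ j = 5))) {X Z : ℝ → ℝ}
    (hX : ContDiff ℝ ∞ X) (hZ : ContDiff ℝ ∞ Z) (hX0 : X 0 ≠ 0) (hZ0 : Z 0 ≠ 0) :
    IsPlaneCusp i j fun t => (t ^ i * X t, t ^ j * Z t) := by
  have key : IsPlaneCusp i j fun t => (t ^ i * ((X 0)⁻¹ * X t), t ^ j * Z t) := by
    obtain ⟨V, hV, hV0, hVX⟩ := exists_contDiff_pow_eventuallyEq (i := i)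
      (X := fun t => (X 0)⁻¹ * X t) (by fun_prop) (by simp [hX0]) (by omega)
    obtain ⟨D, hD, hD'⟩ := exists_contDiff_mul_eventuallyEq (g := fun t => V t ^ j) hZ
      (by fun_prop) (by simp [hV0])
    have hD0 : D 0 ≠ 0 := by
      have := hD'.self_of_nhds
      simp only [hV0, one_pow, mul_one] at this
      rwa [this]
    refine IsPlaneCusp.of_reparametrization hV hV0 hVX hD' fun ψ hψ hψ0 _ => ?_
    have hs : ContDiff ℝ ∞ fun r => D (ψ r) := by fun_prop
    have hs0 : D (ψ 0) ≠ 0 := by rwa [hψ0]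
    rcases hij with ⟨rfl, rfl | rfl⟩ | ⟨rfl, rfl | rfl⟩
    · exact isPlaneCusp_two_of_monomial (k := 1) hs hs0
    · exact isPlaneCusp_two_of_monomial (k := 2) hs hs0
    · exact isPlaneCusp_three_of_cube (.inl rfl) hs hs0
    · exact isPlaneCusp_three_of_cube (.inr rfl) hs hs0
  refine (key.comp_left (isDiffeoGerm_linear (b := 0) hX0 one_ne_zero)).congr
    (Eventually.of_forall fun u => ?_)
  simp only [Function.comp_apply, Prod.mk.injEq, one_mul, and_true]
  field_simp
  ring

/-! ### The frame of the involute -/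

/-- A frame of Lorentz-Minkowski 3-space, orthonormal for the pseudo scalar product, whose first
vector lies in the hyperbolic plane. -/
structure IsLorentzFrame (e₀ e₁ e₂ : Fin 3 → ℝ) : Prop where
  pos : 0 < e₀ 0
  self₀ : lorentz e₀ e₀ = -1
  self₁ : lorentz e₁ e₁ = 1
  self₂ : lorentz e₂ e₂ = 1
  inner₀₁ : lorentz e₀ e₁ = 0
  inner₀₂ : lorentz e₀ e₂ = 0
  inner₁₂ : lorentz e₁ e₂ = 0

theorem lorentz_comm (x y : Fin 3 → ℝ) : lorentz x y = lorentz y x := by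
  simp only [lorentz]; ring

theorem IsLorentzFrame.eq_sum {e₀ e₁ e₂ : Fin 3 → ℝ} (h : IsLorentzFrame e₀ e₁ e₂)
    (x : Fin 3 → ℝ) :
    x = -lorentz x e₀ • e₀ + lorentz x e₁ • e₁ + lorentz x e₂ • e₂ := by
  obtain ⟨-, h00, h11, h22, h01, h02, h12⟩ := h
  simp only [lorentz] at h00 h11 h22 h01 h02 h12
  -- orthonormality of the rows gives orthonormality of the columns
  have hPQ : !![-e₀ 0, e₀ 1, e₀ 2; -e₁ 0, e₁ 1, e₁ 2; -e₂ 0, e₂ 1, e₂ 2] *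
      !![-e₀ 0, e₁ 0, e₂ 0; -e₀ 1, e₁ 1, e₂ 1; -e₀ 2, e₁ 2, e₂ 2] = (1 : Matrix _ _ ℝ) := by
    ext i j
    fin_cases i <;> fin_cases j <;>
      simp [Matrix.mul_apply, Fin.sum_univ_three] <;> linarith
  have hQP := mul_eq_one_comm.1 hPQ
  have h1 := fun i j => congrFun (congrFun hQP i) j
  have a00 := h1 0 0
  have a01 := h1 0 1
  have a02 := h1 0 2
  have a11 := h1 1 1
  have a12 := h1 1 2
  have a22 := h1 2 2
  simp [Matrix.mul_apply, Fin.sum_univ_three] at a00 a01 a02 a11 a12 a22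
  ext i
  fin_cases i <;> simp [lorentz]
  · linear_combination -x 0 * a00 - x 1 * a01 - x 2 * a02
  · linear_combination x 0 * a01 - x 1 * a11 - x 2 * a12
  · linear_combination x 0 * a02 - x 1 * a12 - x 2 * a22

/-- The reversed Cauchy-Schwarz inequality, as a criterion for lying on the branch `x₁ > 0`. -/
theorem pos_iff_lorentz_neg {x e : Fin 3 → ℝ} (hx : lorentz x x = -1) (he : lorentz e e = -1)
    (he0 : 0 < e 0) : 0 < x 0 ↔ lorentz x e < 0 := by
  simp only [lorentz] at *
  have h : (x 1 * e 1 + x 2 * e 2) ^ 2 < (x 0 * e 0) ^ 2 := by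
    nlinarith [sq_nonneg (x 1 * e 2 - x 2 * e 1), sq_nonneg (x 1), sq_nonneg (x 2),
      sq_nonneg (e 1), sq_nonneg (e 2)]
  have h' := sq_lt_sq.1 h
  constructor
  · intro hx0
    rw [abs_of_pos (mul_pos hx0 he0)] at h'
    linarith [(abs_lt.1 h').2]
  · intro hlt
    by_contra! hx0
    rw [abs_of_nonpos (mul_nonpos_of_nonpos_of_nonneg hx0 he0.le)] at h'
    linarith [(abs_lt.1 h').1]

/-- The coordinates along the two spacelike vectors of a Lorentz frame are a chart of the
hyperbolic plane centred at the timelike one. -/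
theorem IsLorentzFrame.isDiffeoGerm {e₀ e₁ e₂ : Fin 3 → ℝ} (h : IsLorentzFrame e₀ e₁ e₂) :
    IsDiffeoGerm hyperbolicPlane e₀ univ (0 : ℝ × ℝ) fun x => (lorentz x e₁, lorentz x e₂) := by
  let Ψ : ℝ × ℝ → Fin 3 → ℝ := fun p => √(1 + p.1 ^ 2 + p.2 ^ 2) • e₀ + p.1 • e₁ + p.2 • e₂
  have hΨ0 : ∀ p, lorentz (Ψ p) e₀ = -√(1 + p.1 ^ 2 + p.2 ^ 2) := fun p => by
    have e : lorentz (Ψ p) e₀ = √(1 + p.1 ^ 2 + p.2 ^ 2) * lorentz e₀ e₀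
      + p.1 * lorentz e₀ e₁ + p.2 * lorentz e₀ e₂ := by simp [Ψ, lorentz]; ring
    rw [e, h.self₀, h.inner₀₁, h.inner₀₂]; ring
  have hΨ1 : ∀ p, lorentz (Ψ p) e₁ = p.1 := fun p => by
    have e : lorentz (Ψ p) e₁ = √(1 + p.1 ^ 2 + p.2 ^ 2) * lorentz e₀ e₁
      + p.1 * lorentz e₁ e₁ + p.2 * lorentz e₁ e₂ := by simp [Ψ, lorentz]; ring
    rw [e, h.self₁, h.inner₀₁, h.inner₁₂]; ring
  have hΨ2 : ∀ p, lorentz (Ψ p) e₂ = p.2 := fun p => by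
    have e : lorentz (Ψ p) e₂ = √(1 + p.1 ^ 2 + p.2 ^ 2) * lorentz e₀ e₂
      + p.1 * lorentz e₁ e₂ + p.2 * lorentz e₂ e₂ := by simp [Ψ, lorentz]; ring
    rw [e, h.self₂, h.inner₀₂, h.inner₁₂]; ring
  have hpos : ∀ p : ℝ × ℝ, 0 < 1 + p.1 ^ 2 + p.2 ^ 2 := fun p => by positivity
  have hself : ∀ x : Fin 3 → ℝ,
      lorentz x x = -lorentz x e₀ ^ 2 + lorentz x e₁ ^ 2 + lorentz x e₂ ^ 2 := fun x => by
    have e : ∀ a b c : ℝ, lorentz x (a • e₀ + b • e₁ + c • e₂)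
      = a * lorentz x e₀ + b * lorentz x e₁ + c * lorentz x e₂ := fun a b c => by
      simp [lorentz]; ring
    calc lorentz x x = lorentz x _ := congrArg (lorentz x) (h.eq_sum x)
      _ = _ := by rw [e]; ring
  have hself' : ∀ p, lorentz (Ψ p) (Ψ p) = -1 := fun p => by
    rw [hself, hΨ0, hΨ1, hΨ2, neg_sq, Real.sq_sqrt (hpos p).le]; ring
  refine ⟨Ψ, univ, univ, isOpen_univ, isOpen_univ, ⟨mem_univ _, h.self₀, h.pos⟩,
    ⟨mem_univ _, mem_univ _⟩, by simp [h.inner₀₁, h.inner₀₂], ?_, ?_, fun _ _ => by simp,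
    ?_, ?_, ?_⟩
  · simp only [lorentz]
    exact ContDiff.contDiffOn (by fun_prop)
  · refine ContDiff.contDiffOn ?_
    have : ContDiff ℝ ∞ fun p : ℝ × ℝ => √(1 + p.1 ^ 2 + p.2 ^ 2) :=
      ContDiff.sqrt (by fun_prop) fun p => (hpos p).ne'
    fun_prop
  · rintro p -
    refine ⟨mem_univ _, hself' p, (pos_iff_lorentz_neg (hself' p) h.self₀ h.pos).2 ?_⟩
    rw [hΨ0, neg_lt_zero]
    exact Real.sqrt_pos.2 (hpos p)
  · rintro x ⟨-, hx, hx0⟩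
    have h1 := (pos_iff_lorentz_neg hx h.self₀ h.pos).1 hx0
    have h2 : √(1 + lorentz x e₁ ^ 2 + lorentz x e₂ ^ 2) = -lorentz x e₀ := by
      rw [hself] at hx
      rw [Real.sqrt_eq_iff_mul_self_eq (hpos (_, _)).le (by linarith)]
      linarith
    simp only [Ψ, h2]
    exact (h.eq_sum x).symm
  · rintro p -
    simp only [hΨ1, hΨ2]

/-- The unit tangent direction of the horocyclic involute: its derivative is a multiple of this
vector, also at singular points. -/
noncomputable def involuteTangent (ε : ℝ) (γ ν : ℝ → Fin 3 → ℝ) (s : ℝ → ℝ) (t : ℝ) : Fin 3 → ℝ :=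
  -ν t + (ε * s t) • frameTangent γ ν t + (s t ^ 2 / 2) • (ε • γ t + ν t)

/-- The unit normal of the horocyclic involute in the hyperbolic plane. -/
noncomputable def involuteNormal (ε : ℝ) (γ ν : ℝ → Fin 3 → ℝ) (s : ℝ → ℝ) (t : ℝ) : Fin 3 → ℝ :=
  frameTangent γ ν t + s t • (γ t + ε • ν t)

theorem lorentz_wedge_self (x y : Fin 3 → ℝ) :
    lorentz (wedge x y) (wedge x y) = lorentz x y ^ 2 - lorentz x x * lorentz y y := by
  simp [lorentz, wedge]; ring

theorem lorentz_wedge_left (x y : Fin 3 → ℝ) : lorentz x (wedge x y) = 0 := by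
  simp [lorentz, wedge]; ring

theorem lorentz_wedge_right (x y : Fin 3 → ℝ) : lorentz y (wedge x y) = 0 := by
  simp [lorentz, wedge]; ring

theorem hasDerivWithinAt_lorentz_const {f : ℝ → Fin 3 → ℝ} {f' : Fin 3 → ℝ} {I : Set ℝ} {t : ℝ}
    (hf : HasDerivWithinAt f f' I t) (e : Fin 3 → ℝ) :
    HasDerivWithinAt (fun t => lorentz (f t) e) (lorentz f' e) I t := by
  have h := hasDerivWithinAt_pi.1 hf
  exact ((((h 0).mul_const (e 0)).neg).add ((h 1).mul_const (e 1))).add ((h 2).mul_const (e 2))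

section Involute

variable {I : Set ℝ} {γ ν : ℝ → Fin 3 → ℝ} {m n s : ℝ → ℝ} {ε : ℝ}

theorem IsSpacelikeLegendreCurve.contDiffOn_frameTangent (h : IsSpacelikeLegendreCurve I γ ν) :
    ContDiffOn ℝ ∞ (frameTangent γ ν) I := by
  have h1 := contDiffOn_pi.1 h.smooth_base
  have h2 := contDiffOn_pi.1 h.smooth_normal
  rw [contDiffOn_pi]
  intro i
  fin_cases i <;> simp only [frameTangent, wedge] <;> simp
  · exact ((((h1 1).mul (h2 2)).sub ((h1 2).mul (h2 1))).neg).congr fun t _ => by simp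
  · exact ((h1 2).mul (h2 0)).sub ((h1 0).mul (h2 2))
  · exact ((h1 0).mul (h2 1)).sub ((h1 1).mul (h2 0))

theorem contDiffOn_lorentz {f g : ℝ → Fin 3 → ℝ} (hf : ContDiffOn ℝ ∞ f I)
    (hg : ContDiffOn ℝ ∞ g I) : ContDiffOn ℝ ∞ (fun t => lorentz (f t) (g t)) I := by
  have h1 := contDiffOn_pi.1 hf
  have h2 := contDiffOn_pi.1 hg
  exact ((((h1 0).mul (h2 0)).neg).add ((h1 1).mul (h2 1))).add ((h1 2).mul (h2 2))

theorem IsSpacelikeLegendreCurve.frame (h : IsSpacelikeLegendreCurve I γ ν) {t : ℝ} (ht : t ∈ I) :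
    IsLorentzFrame (γ t) (ν t) (frameTangent γ ν t) where
  pos := (h.base_mem t ht).2
  self₀ := (h.base_mem t ht).1
  self₁ := h.normal_mem t ht
  self₂ := by
    have h1 : lorentz (ν t) (ν t) = 1 := h.normal_mem t ht
    rw [frameTangent, lorentz_wedge_self, h.orthogonal t ht, (h.base_mem t ht).1, h1]; norm_num
  inner₀₁ := h.orthogonal t ht
  inner₀₂ := lorentz_wedge_left _ _
  inner₁₂ := lorentz_wedge_right _ _

theorem IsLegendreCurvature.contDiffOn_fst (hmn : IsLegendreCurvature I γ ν m n)
    (h : IsSpacelikeLegendreCurve I γ ν) (hI : UniqueDiffOn ℝ I) : ContDiffOn ℝ ∞ m I := by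
  refine (contDiffOn_lorentz (h.smooth_base.derivWithin hI (m := ∞) (by simp))
    h.contDiffOn_frameTangent).congr fun t ht => ?_
  have h1 := (h.frame ht).self₂
  rw [(hmn t ht).1]
  simp only [lorentz, Pi.smul_apply, smul_eq_mul] at h1 ⊢
  linear_combination (-m t) * h1

theorem IsLegendreCurvature.contDiffOn_snd (hmn : IsLegendreCurvature I γ ν m n)
    (h : IsSpacelikeLegendreCurve I γ ν) (hI : UniqueDiffOn ℝ I) : ContDiffOn ℝ ∞ n I := by
  refine (contDiffOn_lorentz (h.smooth_normal.derivWithin hI (m := ∞) (by simp))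
    h.contDiffOn_frameTangent).congr fun t ht => ?_
  have h1 := (h.frame ht).self₂
  rw [(hmn t ht).2.1]
  simp only [lorentz, Pi.smul_apply, smul_eq_mul] at h1 ⊢
  linear_combination (-n t) * h1

theorem IsInvoluteSolution.contDiffOn (hs : IsInvoluteSolution I ε m n s) (hI : UniqueDiffOn ℝ I)
    (hm : ContDiffOn ℝ ∞ m I) (hn : ContDiffOn ℝ ∞ n I) : ContDiffOn ℝ ∞ s I := by
  rw [contDiffOn_infty]
  intro k
  induction k with
  | zero => exact contDiffOn_zero.2 fun t ht => (hs t ht).continuousWithinAt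
  | succ k ih =>
    push_cast
    rw [contDiffOn_succ_iff_derivWithin hI]
    refine ⟨fun t ht => (hs t ht).differentiableWithinAt, by simp, ?_⟩
    have hm' : ContDiffOn ℝ k m I := hm.of_le (by exact_mod_cast le_top)
    have hn' : ContDiffOn ℝ k n I := hn.of_le (by exact_mod_cast le_top)
    refine ContDiffOn.congr (f := fun t => (m t + ε * n t) / 2 * s t ^ 2 - m t) ?_
      fun t ht => (hs t ht).derivWithin (hI t ht)
    exact ((((hm'.add (contDiffOn_const.mul hn')).div_const 2).mul (ih.pow 2)).sub hm')

/-- The moving frame of the involute, which is defined at its singular points as well. -/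
theorem involute_frame (h : IsSpacelikeLegendreCurve I γ ν) (hε : ε = 1 ∨ ε = -1) {t : ℝ}
    (ht : t ∈ I) : IsLorentzFrame (horocyclicInvolute ε γ ν s t) (involuteTangent ε γ ν s t)
      (involuteNormal ε γ ν s t) := by
  obtain ⟨hpos, h00, h11, h22, h01, h02, h12⟩ := h.frame ht
  have hε : ε ^ 2 = 1 := by rcases hε with rfl | rfl <;> norm_num
  have hself : lorentz (horocyclicInvolute ε γ ν s t) (horocyclicInvolute ε γ ν s t) = -1 := by
    simp only [lorentz, horocyclicInvolute, Pi.add_apply, Pi.smul_apply, smul_eq_mul] at *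
    linear_combination (1 + s t ^ 2 / 2) ^ 2 * h00 + s t ^ 2 * h22 + (s t ^ 2 / 2) ^ 2 * ε ^ 2 * h11
      + 2 * (1 + s t ^ 2 / 2) * s t * h02 + 2 * (1 + s t ^ 2 / 2) * (s t ^ 2 / 2) * ε * h01
      + 2 * s t * (s t ^ 2 / 2) * ε * h12 + (s t ^ 2 / 2) ^ 2 * hε
  have hγ : lorentz (horocyclicInvolute ε γ ν s t) (γ t) < 0 := by
    have : lorentz (horocyclicInvolute ε γ ν s t) (γ t) = -(1 + s t ^ 2 / 2) := by
      simp only [lorentz, horocyclicInvolute, Pi.add_apply, Pi.smul_apply, smul_eq_mul] at *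
      linear_combination (1 + s t ^ 2 / 2) * h00 + s t * h02 + s t ^ 2 / 2 * ε * h01
    rw [this, neg_lt_zero]; positivity
  refine ⟨(pos_iff_lorentz_neg hself h00 hpos).2 hγ, hself, ?_, ?_, ?_, ?_, ?_⟩ <;> clear hself hγ
  all_goals
    simp only [lorentz, horocyclicInvolute, involuteTangent, involuteNormal, Pi.add_apply,
      Pi.neg_apply, Pi.smul_apply, smul_eq_mul] at *
  · linear_combination (s t ^ 2 / 2 * ε) ^ 2 * h00 + (s t ^ 2 / 2 - 1) ^ 2 * h11
      + (ε * s t) ^ 2 * h22 + 2 * (s t ^ 2 / 2 * ε) * (s t ^ 2 / 2 - 1) * h01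
      + 2 * (s t ^ 2 / 2 * ε) * (ε * s t) * h02 + 2 * (s t ^ 2 / 2 - 1) * (ε * s t) * h12
      + (s t ^ 2 - (s t ^ 2 / 2) ^ 2) * hε
  · linear_combination s t ^ 2 * h00 + (s t * ε) ^ 2 * h11 + h22 + 2 * s t * (s t * ε) * h01
      + 2 * s t * h02 + 2 * (s t * ε) * h12 + s t ^ 2 * hε
  · linear_combination (1 + s t ^ 2 / 2) * (s t ^ 2 / 2 * ε) * h00
      + s t ^ 2 / 2 * ε * (s t ^ 2 / 2 - 1) * h11 + s t * (ε * s t) * h22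
      + ((1 + s t ^ 2 / 2) * (s t ^ 2 / 2 - 1) + s t ^ 2 / 2 * ε * (s t ^ 2 / 2 * ε)) * h01
      + ((1 + s t ^ 2 / 2) * (ε * s t) + s t * (s t ^ 2 / 2 * ε)) * h02
      + (s t ^ 2 / 2 * ε * (ε * s t) + s t * (s t ^ 2 / 2 - 1)) * h12
  · linear_combination (1 + s t ^ 2 / 2) * s t * h00
      + s t ^ 2 / 2 * ε * (s t * ε) * h11 + s t * h22
      + ((1 + s t ^ 2 / 2) * (s t * ε) + s t ^ 2 / 2 * ε * s t) * h01
      + ((1 + s t ^ 2 / 2) + s t * s t) * h02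
      + (s t ^ 2 / 2 * ε + s t * (s t * ε)) * h12 + s t ^ 3 / 2 * hε
  · linear_combination (s t ^ 2 / 2 * ε) * s t * h00
      + (s t ^ 2 / 2 - 1) * (s t * ε) * h11 + ε * s t * h22
      + ((s t ^ 2 / 2 * ε) * (s t * ε) + (s t ^ 2 / 2 - 1) * s t) * h01
      + ((s t ^ 2 / 2 * ε) + ε * s t * s t) * h02
      + ((s t ^ 2 / 2 - 1) + ε * s t * (s t * ε)) * h12

theorem hasDerivWithinAt_frame (h : IsSpacelikeLegendreCurve I γ ν)
    (hmn : IsLegendreCurvature I γ ν m n) {t : ℝ} (ht : t ∈ I) :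
    HasDerivWithinAt γ (m t • frameTangent γ ν t) I t ∧
    HasDerivWithinAt ν (n t • frameTangent γ ν t) I t ∧
    HasDerivWithinAt (frameTangent γ ν) (m t • γ t - n t • ν t) I t := by
  obtain ⟨h1, h2, h3⟩ := hmn t ht
  exact ⟨h1 ▸ (h.smooth_base.differentiableOn (by simp) t ht).hasDerivWithinAt,
    h2 ▸ (h.smooth_normal.differentiableOn (by simp) t ht).hasDerivWithinAt,
    h3 ▸ (h.contDiffOn_frameTangent.differentiableOn (by simp) t ht).hasDerivWithinAt⟩

/-- The first of the Frenet formulas of the involute. With `k = n + ε m` its frame has the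
curvatures `s k`, the speed along the tangent, and `k`, the rotation of the tangent. -/
theorem hasDerivWithinAt_horocyclicInvolute (h : IsSpacelikeLegendreCurve I γ ν)
    (hmn : IsLegendreCurvature I γ ν m n) (hs : IsInvoluteSolution I ε m n s) (hε : ε = 1 ∨ ε = -1)
    {t : ℝ} (ht : t ∈ I) :
    HasDerivWithinAt (horocyclicInvolute ε γ ν s)
      ((s t * (n t + ε * m t)) • involuteTangent ε γ ν s t) I t := by
  obtain ⟨h1, h2, h3⟩ := hasDerivWithinAt_frame h hmn ht
  have h4 := hs t ht
  refine ((h1.add (h4.smul h3)).add (((h4.pow 2).div_const 2).smul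
    (h1.add (h2.const_smul ε)))).congr_deriv ?_
  ext i
  simp only [involuteTangent, Pi.add_apply, Pi.sub_apply, Pi.neg_apply, Pi.smul_apply,
    smul_eq_mul, Pi.pow_apply]
  push_cast
  rcases hε with rfl | rfl <;> ring

theorem hasDerivWithinAt_involuteTangent (h : IsSpacelikeLegendreCurve I γ ν)
    (hmn : IsLegendreCurvature I γ ν m n) (hs : IsInvoluteSolution I ε m n s) (hε : ε = 1 ∨ ε = -1)
    {t : ℝ} (ht : t ∈ I) :
    HasDerivWithinAt (involuteTangent ε γ ν s)
      ((n t + ε * m t) • (s t • horocyclicInvolute ε γ ν s t - involuteNormal ε γ ν s t)) I t := by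
  obtain ⟨h1, h2, h3⟩ := hasDerivWithinAt_frame h hmn ht
  have h4 := hs t ht
  refine ((h2.neg.add ((h4.const_mul ε).smul h3)).add (((h4.pow 2).div_const 2).smul
    ((h1.const_smul ε).add h2))).congr_deriv ?_
  ext i
  simp only [involuteNormal, horocyclicInvolute, Pi.add_apply, Pi.sub_apply, Pi.neg_apply,
    Pi.smul_apply, smul_eq_mul, Pi.pow_apply]
  push_cast
  rcases hε with rfl | rfl <;> ring

theorem hasDerivWithinAt_involuteNormal (h : IsSpacelikeLegendreCurve I γ ν)
    (hmn : IsLegendreCurvature I γ ν m n) (hs : IsInvoluteSolution I ε m n s) (hε : ε = 1 ∨ ε = -1)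
    {t : ℝ} (ht : t ∈ I) :
    HasDerivWithinAt (involuteNormal ε γ ν s)
      ((n t + ε * m t) • involuteTangent ε γ ν s t) I t := by
  obtain ⟨h1, h2, h3⟩ := hasDerivWithinAt_frame h hmn ht
  refine (h3.add ((hs t ht).smul (h1.add (h2.const_smul ε)))).congr_deriv ?_
  ext i
  simp only [involuteTangent, Pi.add_apply, Pi.sub_apply, Pi.neg_apply, Pi.smul_apply,
    smul_eq_mul]
  rcases hε with rfl | rfl <;> ring

end Involute

/-! ### Orders of the coordinates of the involute -/

/-- `(x, y)`, `(a, b)` and `(p, q)` are the coordinates of the involute, of its unit tangent and of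
its unit normal along the tangent and the normal at `t₀`; with `k = n + ε m`, the differential
equations are `(x, y)' = s k (a, b)`, `(a, b)' = k (s (x, y) - (p, q))` and `(p, q)' = k (a, b)`.
The initial values say that the frame at `t₀` is orthonormal. -/
structure IsInvoluteCoordinates (I : Set ℝ) (t₀ ε : ℝ) (m n s x y a b p q : ℝ → ℝ) : Prop where
  ordConnected : I.OrdConnected
  nontrivial : I.Nontrivial
  mem : t₀ ∈ I
  smooth_m : ContDiffOn ℝ ∞ m I
  smooth_n : ContDiffOn ℝ ∞ n I
  smooth_s : ContDiffOn ℝ ∞ s I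
  smooth_x : ContDiffOn ℝ ∞ x I
  smooth_y : ContDiffOn ℝ ∞ y I
  smooth_a : ContDiffOn ℝ ∞ a I
  smooth_b : ContDiffOn ℝ ∞ b I
  smooth_p : ContDiffOn ℝ ∞ p I
  smooth_q : ContDiffOn ℝ ∞ q I
  sign : ε = 1 ∨ ε = -1
  deriv_s : IsInvoluteSolution I ε m n s
  deriv_x : ∀ t ∈ I, HasDerivWithinAt x (s t * (n t + ε * m t) * a t) I t
  deriv_y : ∀ t ∈ I, HasDerivWithinAt y (s t * (n t + ε * m t) * b t) I t
  deriv_a : ∀ t ∈ I, HasDerivWithinAt a ((n t + ε * m t) * (s t * x t - p t)) I t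
  deriv_b : ∀ t ∈ I, HasDerivWithinAt b ((n t + ε * m t) * (s t * y t - q t)) I t
  deriv_p : ∀ t ∈ I, HasDerivWithinAt p ((n t + ε * m t) * a t) I t
  deriv_q : ∀ t ∈ I, HasDerivWithinAt q ((n t + ε * m t) * b t) I t
  x_zero : x t₀ = 0
  y_zero : y t₀ = 0
  a_one : a t₀ = 1
  b_zero : b t₀ = 0
  p_zero : p t₀ = 0
  q_one : q t₀ = 1

namespace IsInvoluteCoordinates

variable {I : Set ℝ} {t₀ ε : ℝ} {m n s x y a b p q : ℝ → ℝ}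

theorem uniqueDiffOn (D : IsInvoluteCoordinates I t₀ ε m n s x y a b p q) : UniqueDiffOn ℝ I :=
  D.ordConnected.uniqueDiffOn D.nontrivial

theorem accPt (D : IsInvoluteCoordinates I t₀ ε m n s x y a b p q) : AccPt t₀ (𝓟 I) :=
  uniqueDiffWithinAt_iff_accPt.1 (D.uniqueDiffOn t₀ D.mem)

theorem leading_zero (D : IsInvoluteCoordinates I t₀ ε m n s x y a b p q) {f : ℝ → ℝ}
    (hf : ContDiffOn ℝ ∞ f I) : HasLeadingTerm I t₀ 0 (f t₀) f :=
  .of_contDiffOn D.ordConnected D.nontrivial D.mem hf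

theorem leading_succ (D : IsInvoluteCoordinates I t₀ ε m n s x y a b p q) {f f' : ℝ → ℝ}
    (hf : ContDiffOn ℝ ∞ f I) (h : ∀ t ∈ I, HasDerivWithinAt f (f' t) I t) (h0 : f t₀ = 0)
    {i : ℕ} {l : ℝ} (hl : HasLeadingTerm I t₀ i l f') :
    HasLeadingTerm I t₀ (i + 1) (l / (i + 1)) f :=
  .of_hasDerivWithinAt D.accPt D.uniqueDiffOn h D.mem h0 (D.leading_zero hf) hl

theorem leading_one (D : IsInvoluteCoordinates I t₀ ε m n s x y a b p q) {f : ℝ → ℝ}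
    (hf : ContDiffOn ℝ ∞ f I) (h0 : f t₀ = 0) :
    HasLeadingTerm I t₀ 1 (derivWithin f I t₀) f :=
  (D.leading_succ (i := 0) hf (fun t ht => (hf.differentiableOn (by simp) t ht).hasDerivWithinAt) h0
    (D.leading_zero (hf.derivWithin D.uniqueDiffOn (by simp)))).congr_coeff (by simp)

theorem smooth_k (D : IsInvoluteCoordinates I t₀ ε m n s x y a b p q) :
    ContDiffOn ℝ ∞ (fun t => n t + ε * m t) I :=
  D.smooth_n.add (contDiffOn_const.mul D.smooth_m)

theorem derivWithin_k (D : IsInvoluteCoordinates I t₀ ε m n s x y a b p q) :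
    derivWithin (fun t => n t + ε * m t) I t₀ = derivWithin n I t₀ + ε * derivWithin m I t₀ := by
  have h1 := (D.smooth_n.differentiableOn (by simp) t₀ D.mem).hasDerivWithinAt
  have h2 := (D.smooth_m.differentiableOn (by simp) t₀ D.mem).hasDerivWithinAt
  exact (h1.add (h2.const_mul ε)).derivWithin (D.uniqueDiffOn t₀ D.mem)

theorem deriv_s' (D : IsInvoluteCoordinates I t₀ ε m n s x y a b p q) (t : ℝ) (ht : t ∈ I) :
    HasDerivWithinAt s (ε * (n t + ε * m t) / 2 * s t ^ 2 - m t) I t := by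
  refine (D.deriv_s t ht).congr_deriv ?_
  rcases D.sign with rfl | rfl <;> ring

/-- The factor `g` in `B' = k g`, where `z' = s k B` for `z = y - K x ^ 2` and `k = n + ε m`. -/
def bendFactor (K : ℝ) (s x y a p q : ℝ → ℝ) (t : ℝ) : ℝ :=
  s t * y t - q t - 2 * K * (s t * a t ^ 2 + x t * (s t * x t - p t))

theorem smooth_bendFactor (D : IsInvoluteCoordinates I t₀ ε m n s x y a b p q) (K : ℝ) :
    ContDiffOn ℝ ∞ (bendFactor K s x y a p q) I := by
  have h1 := D.smooth_s
  have h2 := D.smooth_x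
  have h3 := D.smooth_y
  have h4 := D.smooth_a
  have h5 := D.smooth_p
  have h6 := D.smooth_q
  unfold bendFactor
  fun_prop

theorem bendFactor_apply (D : IsInvoluteCoordinates I t₀ ε m n s x y a b p q) (K : ℝ) :
    bendFactor K s x y a p q t₀ = -1 - 2 * K * s t₀ := by
  simp [bendFactor, D.y_zero, D.x_zero, D.q_one, D.a_one]

theorem derivWithin_bendFactor (D : IsInvoluteCoordinates I t₀ ε m n s x y a b p q) (K : ℝ)
    (hk : n t₀ + ε * m t₀ = 0) :
    derivWithin (bendFactor K s x y a p q) I t₀ = 2 * K * m t₀ := by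
  have hs := D.deriv_s' t₀ D.mem
  have hx := D.deriv_x t₀ D.mem
  have hy := D.deriv_y t₀ D.mem
  have ha := D.deriv_a t₀ D.mem
  have hp := D.deriv_p t₀ D.mem
  have hq := D.deriv_q t₀ D.mem
  have h := ((hs.mul hy).sub hq).sub
    (((hs.mul (ha.pow 2)).add (hx.mul ((hs.mul hx).sub hp))).const_mul (2 * K))
  refine (h.derivWithin (D.uniqueDiffOn t₀ D.mem)).trans ?_
  simp [hk, D.y_zero, D.x_zero, D.a_one, D.p_zero]

/-- With `k = n + ε m`, the orders of `x` and of `z = y - K x ^ 2` are read off from those of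
`s k` and of `k g`, where `x' = s k a`, `z' = s k B`, `B' = k g`. -/
theorem leading_iff (D : IsInvoluteCoordinates I t₀ ε m n s x y a b p q) (K : ℝ) (i d : ℕ) :
    ((∃ l ≠ 0, HasLeadingTerm I t₀ (i + 1) l x) ∧
      ∃ l ≠ 0, HasLeadingTerm I t₀ (d + 1 + i + 1) l fun t => y t - K * x t ^ 2) ↔
    (∃ l ≠ 0, HasLeadingTerm I t₀ i l fun t => s t * (n t + ε * m t)) ∧
      ∃ l ≠ 0, HasLeadingTerm I t₀ d l
        fun t => bendFactor K s x y a p q t * (n t + ε * m t) := by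
  have hI := D.uniqueDiffOn
  have hx := D.smooth_x
  have hy := D.smooth_y
  have ha := D.smooth_a
  have hb := D.smooth_b
  have hsk : ContDiffOn ℝ ∞ (fun t => s t * (n t + ε * m t)) I := D.smooth_s.mul D.smooth_k
  have ha0 : HasLeadingTerm I t₀ 0 1 a := (D.leading_zero ha).congr_coeff D.a_one
  have hB : ContDiffOn ℝ ∞ (fun t => b t - 2 * K * (x t * a t)) I := by fun_prop
  have hz : ContDiffOn ℝ ∞ (fun t => y t - K * x t ^ 2) I := by fun_prop
  have hz' : ∀ t ∈ I, HasDerivWithinAt (fun t => y t - K * x t ^ 2)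
      ((b t - 2 * K * (x t * a t)) * (s t * (n t + ε * m t))) I t := fun t ht =>
    ((D.deriv_y t ht).sub (((D.deriv_x t ht).pow 2).const_mul K)).congr_deriv (by
      push_cast; ring)
  have hB' : ∀ t ∈ I, HasDerivWithinAt (fun t => b t - 2 * K * (x t * a t))
      (bendFactor K s x y a p q t * (n t + ε * m t)) I t := fun t ht =>
    ((D.deriv_b t ht).sub (((D.deriv_x t ht).mul (D.deriv_a t ht)).const_mul (2 * K))).congr_deriv
      (by simp only [bendFactor]; ring)
  constructor
  · rintro ⟨⟨l, hl, h1⟩, l', hl', h2⟩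
    have h3 := HasLeadingTerm.of_mul (n := i) D.accPt (D.leading_zero hsk) ha0 one_ne_zero
      (h1.hasDerivWithinAt hI D.deriv_x)
    have hi : (i : ℝ) + 1 ≠ 0 := by positivity
    have hl3 : (i + 1) * l / 1 ≠ 0 := by simp [hi, hl]
    refine ⟨⟨_, hl3, h3⟩, ?_⟩
    have h4 := HasLeadingTerm.of_mul (n := d + 1) D.accPt (D.leading_zero hB) h3 hl3
      (h2.hasDerivWithinAt hI hz')
    refine ⟨_, ?_, h4.hasDerivWithinAt hI hB'⟩
    have hd : (d : ℝ) + 1 ≠ 0 := by positivity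
    have hdi : ((d + 1 + i : ℕ) : ℝ) + 1 ≠ 0 := by positivity
    exact mul_ne_zero hd (div_ne_zero (mul_ne_zero hdi hl') hl3)
  · rintro ⟨⟨l, hl, h1⟩, l', hl', h2⟩
    have h3 := D.leading_succ hx D.deriv_x D.x_zero (h1.mul ha0)
    have h4 := D.leading_succ hB hB' (by simp [D.b_zero, D.x_zero]) h2
    have h5 := D.leading_succ hz hz' (by simp [D.y_zero, D.x_zero]) (h4.mul h1)
    refine ⟨⟨_, ?_, h3⟩, _, ?_, h5⟩
    · simp only [add_zero, mul_one]
      positivity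
    · positivity

theorem leading_s (D : IsInvoluteCoordinates I t₀ ε m n s x y a b p q) (h0 : s t₀ = 0) :
    HasLeadingTerm I t₀ 1 (-m t₀) s :=
  (D.leading_one D.smooth_s h0).congr_coeff
    (((D.deriv_s t₀ D.mem).derivWithin (D.uniqueDiffOn t₀ D.mem)).trans (by simp [h0]))

theorem leading_k (D : IsInvoluteCoordinates I t₀ ε m n s x y a b p q)
    (h0 : n t₀ + ε * m t₀ = 0) :
    HasLeadingTerm I t₀ 1 (derivWithin n I t₀ + ε * derivWithin m I t₀)
      fun t => n t + ε * m t :=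
  (D.leading_one D.smooth_k h0).congr_coeff D.derivWithin_k

theorem leading_bendFactor (D : IsInvoluteCoordinates I t₀ ε m n s x y a b p q) (K : ℝ) :
    HasLeadingTerm I t₀ 0 (-1 - 2 * K * s t₀) (bendFactor K s x y a p q) :=
  (D.leading_zero (D.smooth_bendFactor K)).congr_coeff (D.bendFactor_apply K)

/-- `k` vanishes when `s k` and `k g` do: otherwise `s` vanishes, and then `g` does not. -/
theorem k_eq_zero (D : IsInvoluteCoordinates I t₀ ε m n s x y a b p q) (K : ℝ)
    (h1 : s t₀ * (n t₀ + ε * m t₀) = 0)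
    (h2 : bendFactor K s x y a p q t₀ * (n t₀ + ε * m t₀) = 0) : n t₀ + ε * m t₀ = 0 := by
  by_contra hk
  have h3 : s t₀ = 0 := by simpa [hk] using h1
  rw [D.bendFactor_apply, h3] at h2
  exact mul_ne_zero (by norm_num) hk h2

theorem leading_iff_two_three (D : IsInvoluteCoordinates I t₀ ε m n s x y a b p q) :
    (∃ K, (∃ l ≠ 0, HasLeadingTerm I t₀ 2 l x) ∧
      ∃ l ≠ 0, HasLeadingTerm I t₀ 3 l fun t => y t - K * x t ^ 2) ↔
    s t₀ = 0 ∧ m t₀ ≠ 0 ∧ n t₀ + ε * m t₀ ≠ 0 := by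
  simp only [D.leading_iff _ 1 0]
  constructor
  · rintro ⟨K, ⟨l, hl, h1⟩, l', hl', h2⟩
    have hk : n t₀ + ε * m t₀ ≠ 0 := fun hk => hl' (by rw [← h2.apply_eq D.mem]; simp [hk])
    have h3 := HasLeadingTerm.of_mul (n := 1) D.accPt (D.leading_zero D.smooth_s)
      (D.leading_zero D.smooth_k) hk h1
    have hs0 := h3.apply_eq_zero one_ne_zero D.mem
    refine ⟨hs0, fun hm => div_ne_zero hl hk ?_, hk⟩
    rw [h3.unique D.accPt (D.leading_s hs0), hm, neg_zero]
  · rintro ⟨hs, hm, hk⟩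
    refine ⟨0, ⟨_, ?_, (D.leading_s hs).mul (D.leading_zero D.smooth_k)⟩, _, ?_,
      (D.leading_bendFactor 0).mul (D.leading_zero D.smooth_k)⟩
    · exact mul_ne_zero (neg_ne_zero.2 hm) hk
    · exact mul_ne_zero (by norm_num) hk

theorem leading_iff_three_four (D : IsInvoluteCoordinates I t₀ ε m n s x y a b p q) :
    (∃ K, (∃ l ≠ 0, HasLeadingTerm I t₀ 3 l x) ∧
      ∃ l ≠ 0, HasLeadingTerm I t₀ 4 l fun t => y t - K * x t ^ 2) ↔
    s t₀ = 0 ∧ m t₀ = 0 ∧ n t₀ ≠ 0 ∧ derivWithin m I t₀ ≠ 0 := by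
  simp only [D.leading_iff _ 2 0]
  -- the quadratic term of the Riccati equation does not contribute to first order
  have hquad : s t₀ = 0 →
      HasLeadingTerm I t₀ 1 0 fun t => ε * (n t + ε * m t) / 2 * s t ^ 2 := fun hs => by
    have hc : ContDiffOn ℝ ∞ (fun t => ε * (n t + ε * m t) / 2) I :=
      (contDiffOn_const.mul D.smooth_k).div_const 2
    exact ((D.leading_zero hc).mul ((D.leading_s hs).pow 2)).of_add (n := 1) (m := 1) one_ne_zero
  constructor
  · rintro ⟨K, ⟨l, hl, h1⟩, l', hl', h2⟩
    have hk : n t₀ + ε * m t₀ ≠ 0 := fun hk => hl' (by rw [← h2.apply_eq D.mem]; simp [hk])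
    have h3 := HasLeadingTerm.of_mul (n := 2) D.accPt (D.leading_zero D.smooth_s)
      (D.leading_zero D.smooth_k) hk h1
    have hs0 := h3.apply_eq_zero two_ne_zero D.mem
    have hm0 : m t₀ = 0 := by
      have := (D.leading_s hs0).unique D.accPt (h3.of_add (n := 1) (m := 1) one_ne_zero)
      linarith
    have h4 := h3.hasDerivWithinAt (n := 1) D.uniqueDiffOn D.deriv_s'
    have h5 := h4.unique D.accPt ((hquad hs0).sub (D.leading_one D.smooth_m hm0))
    refine ⟨hs0, hm0, by simpa [hm0] using hk, fun hm' => ?_⟩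
    rw [hm', sub_zero] at h5
    have := div_ne_zero hl hk
    push_cast at h5
    exact this (by linarith)
  · rintro ⟨hs, hm, hn, hm'⟩
    have hk : n t₀ + ε * m t₀ ≠ 0 := by simpa [hm] using hn
    have h1 := D.leading_succ D.smooth_s D.deriv_s' hs
      ((hquad hs).sub (D.leading_one D.smooth_m hm))
    refine ⟨0, ⟨_, ?_, h1.mul (D.leading_zero D.smooth_k)⟩, _, ?_,
      (D.leading_bendFactor 0).mul (D.leading_zero D.smooth_k)⟩
    · refine mul_ne_zero (div_ne_zero (by simpa using hm') (by norm_num)) hk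
    · exact mul_ne_zero (by norm_num) hk

theorem leading_iff_three_five (D : IsInvoluteCoordinates I t₀ ε m n s x y a b p q) :
    (∃ K, (∃ l ≠ 0, HasLeadingTerm I t₀ 3 l x) ∧
      ∃ l ≠ 0, HasLeadingTerm I t₀ 5 l fun t => y t - K * x t ^ 2) ↔
    s t₀ = 0 ∧ n t₀ + ε * m t₀ = 0 ∧
        derivWithin n I t₀ + ε * derivWithin m I t₀ ≠ 0 ∧ m t₀ ≠ 0 := by
  simp only [D.leading_iff _ 2 1]
  constructor
  · rintro ⟨K, ⟨l, hl, h1⟩, l', hl', h2⟩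
    have hk := D.k_eq_zero K (h1.apply_eq_zero two_ne_zero D.mem)
      (h2.apply_eq_zero one_ne_zero D.mem)
    have hk1 : derivWithin n I t₀ + ε * derivWithin m I t₀ ≠ 0 := fun h => hl' (by
      rw [h2.unique D.accPt ((D.leading_bendFactor K).mul (D.leading_k hk)), h, mul_zero])
    have h3 := HasLeadingTerm.of_mul (n := 1) D.accPt (D.leading_zero D.smooth_s)
      (D.leading_k hk) hk1 h1
    have hs0 := h3.apply_eq_zero one_ne_zero D.mem
    refine ⟨hs0, hk, hk1, fun hm => div_ne_zero hl hk1 ?_⟩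
    rw [h3.unique D.accPt (D.leading_s hs0), hm, neg_zero]
  · rintro ⟨hs, hk, hk1, hm⟩
    refine ⟨0, ⟨_, ?_, (D.leading_s hs).mul (D.leading_k hk)⟩, _, ?_,
      (D.leading_bendFactor 0).mul (D.leading_k hk)⟩
    · exact mul_ne_zero (neg_ne_zero.2 hm) hk1
    · exact mul_ne_zero (by norm_num) hk1

theorem leading_iff_two_five (D : IsInvoluteCoordinates I t₀ ε m n s x y a b p q) :
    (∃ K, (∃ l ≠ 0, HasLeadingTerm I t₀ 2 l x) ∧
      ∃ l ≠ 0, HasLeadingTerm I t₀ 5 l fun t => y t - K * x t ^ 2) ↔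
    n t₀ + ε * m t₀ = 0 ∧ derivWithin n I t₀ + ε * derivWithin m I t₀ ≠ 0 ∧
        s t₀ ≠ 0 ∧ m t₀ ≠ 0 := by
  simp only [D.leading_iff _ 1 2]
  constructor
  · rintro ⟨K, ⟨l, hl, h1⟩, l', hl', h2⟩
    have hk := D.k_eq_zero K (h1.apply_eq_zero one_ne_zero D.mem)
      (h2.apply_eq_zero two_ne_zero D.mem)
    have h3 := h1.unique D.accPt ((D.leading_zero D.smooth_s).mul (D.leading_k hk))
    rw [h3] at hl
    have hk1 := right_ne_zero_of_mul hl
    have h4 := HasLeadingTerm.of_mul (n := 1) D.accPt (D.leading_bendFactor K)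
      (D.leading_k hk) hk1 h2
    have h5 := h4.unique D.accPt (D.leading_one (D.smooth_bendFactor K)
      (h4.apply_eq_zero one_ne_zero D.mem))
    rw [D.derivWithin_bendFactor K hk] at h5
    have h6 := div_ne_zero hl' hk1
    rw [h5] at h6
    exact ⟨hk, hk1, left_ne_zero_of_mul hl, right_ne_zero_of_mul h6⟩
  · rintro ⟨hk, hk1, hs, hm⟩
    -- this choice of `K` makes `g` vanish
    have hg : bendFactor (-1 / (2 * s t₀)) s x y a p q t₀ = 0 := by
      rw [D.bendFactor_apply]; field_simp; ring
    have h1 := D.leading_one (D.smooth_bendFactor _) hg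
    rw [D.derivWithin_bendFactor _ hk] at h1
    refine ⟨-1 / (2 * s t₀), ⟨_, ?_, (D.leading_zero D.smooth_s).mul (D.leading_k hk)⟩, _, ?_,
      h1.mul (D.leading_k hk)⟩
    · exact mul_ne_zero hs hk1
    · refine mul_ne_zero (mul_ne_zero (mul_ne_zero two_ne_zero ?_) hm) hk1
      exact div_ne_zero (by norm_num) (mul_ne_zero two_ne_zero hs)

end IsInvoluteCoordinates

/-! ### Cusps and orders of vanishing -/

section Criterion

variable {I : Set ℝ} {t₀ ε : ℝ} {m n s : ℝ → ℝ} {γ ν : ℝ → Fin 3 → ℝ}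

/-- The Frenet formulas of the involute, in the chart given by its frame at `t₀`. -/
theorem isInvoluteCoordinates (hI : I.OrdConnected) (hI' : I.Nontrivial)
    (h : IsSpacelikeLegendreCurve I γ ν) (hmn : IsLegendreCurvature I γ ν m n)
    (hε : ε = 1 ∨ ε = -1) (hs : IsInvoluteSolution I ε m n s) (ht₀ : t₀ ∈ I) :
    IsInvoluteCoordinates I t₀ ε m n s
      (fun t => lorentz (horocyclicInvolute ε γ ν s t) (involuteTangent ε γ ν s t₀))
      (fun t => lorentz (horocyclicInvolute ε γ ν s t) (involuteNormal ε γ ν s t₀))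
      (fun t => lorentz (involuteTangent ε γ ν s t) (involuteTangent ε γ ν s t₀))
      (fun t => lorentz (involuteTangent ε γ ν s t) (involuteNormal ε γ ν s t₀))
      (fun t => lorentz (involuteNormal ε γ ν s t) (involuteTangent ε γ ν s t₀))
      (fun t => lorentz (involuteNormal ε γ ν s t) (involuteNormal ε γ ν s t₀)) := by
  have hU := hI.uniqueDiffOn hI'
  have hm := hmn.contDiffOn_fst h hU
  have hn := hmn.contDiffOn_snd h hU
  have hs' := hs.contDiffOn hU hm hn
  have hγ := h.smooth_base
  have hν := h.smooth_normal
  have hμ := h.contDiffOn_frameTangent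
  have hc : ContDiffOn ℝ ∞ (horocyclicInvolute ε γ ν s) I := by
    unfold horocyclicInvolute; fun_prop
  have hw : ContDiffOn ℝ ∞ (involuteTangent ε γ ν s) I := by
    unfold involuteTangent; fun_prop
  have hN : ContDiffOn ℝ ∞ (involuteNormal ε γ ν s) I := by
    unfold involuteNormal; fun_prop
  have hf := involute_frame (s := s) h hε ht₀
  exact
    { ordConnected := hI
      nontrivial := hI'
      mem := ht₀
      smooth_m := hm
      smooth_n := hn
      smooth_s := hs'
      smooth_x := contDiffOn_lorentz hc contDiffOn_const
      smooth_y := contDiffOn_lorentz hc contDiffOn_const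
      smooth_a := contDiffOn_lorentz hw contDiffOn_const
      smooth_b := contDiffOn_lorentz hw contDiffOn_const
      smooth_p := contDiffOn_lorentz hN contDiffOn_const
      smooth_q := contDiffOn_lorentz hN contDiffOn_const
      sign := hε
      deriv_s := hs
      deriv_x := fun t ht => (hasDerivWithinAt_lorentz_const
        (hasDerivWithinAt_horocyclicInvolute h hmn hs hε ht) _).congr_deriv (by
          simp only [lorentz, Pi.smul_apply, smul_eq_mul]; ring)
      deriv_y := fun t ht => (hasDerivWithinAt_lorentz_const
        (hasDerivWithinAt_horocyclicInvolute h hmn hs hε ht) _).congr_deriv (by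
          simp only [lorentz, Pi.smul_apply, smul_eq_mul]; ring)
      deriv_a := fun t ht => (hasDerivWithinAt_lorentz_const
        (hasDerivWithinAt_involuteTangent h hmn hs hε ht) _).congr_deriv (by
          simp only [lorentz, Pi.smul_apply, Pi.sub_apply, smul_eq_mul]; ring)
      deriv_b := fun t ht => (hasDerivWithinAt_lorentz_const
        (hasDerivWithinAt_involuteTangent h hmn hs hε ht) _).congr_deriv (by
          simp only [lorentz, Pi.smul_apply, Pi.sub_apply, smul_eq_mul]; ring)
      deriv_p := fun t ht => (hasDerivWithinAt_lorentz_const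
        (hasDerivWithinAt_involuteNormal h hmn hs hε ht) _).congr_deriv (by
          simp only [lorentz, Pi.smul_apply, smul_eq_mul]; ring)
      deriv_q := fun t ht => (hasDerivWithinAt_lorentz_const
        (hasDerivWithinAt_involuteNormal h hmn hs hε ht) _).congr_deriv (by
          simp only [lorentz, Pi.smul_apply, smul_eq_mul]; ring)
      x_zero := hf.inner₀₁
      y_zero := hf.inner₀₂
      a_one := hf.self₁
      b_zero := hf.inner₁₂
      p_zero := (lorentz_comm _ _).trans hf.inner₁₂
      q_one := hf.self₂ }

/-- Along the curve `(φ ^ i, φ ^ j)` the leading term of `H` in the second variable is linear. -/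
theorem leading_comp_monomial_sub {H : ℝ × ℝ → ℝ} (hH : ContDiff ℝ ∞ H) (hI : I.OrdConnected)
    (hI' : I.Nontrivial) (ht₀ : t₀ ∈ I) {i j : ℕ} (hi : i ≠ 0) (hj : j ≠ 0) {φ ψ : ℝ → ℝ}
    (hφ : ContDiff ℝ ∞ φ) (hψ : ContDiff ℝ ∞ ψ) (hφψ : ∀ t, φ t = (t - t₀) * ψ t) :
    HasLeadingTerm I t₀ j (ψ t₀ ^ j * fderiv ℝ H 0 (0, 1))
      fun t => H (φ t ^ i, φ t ^ j) - H (φ t ^ i, 0) := by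
  have hs : ContDiff ℝ ∞ fun t => H (φ t ^ i, φ t ^ j) - H (φ t ^ i, 0) :=
    (hH.comp ((hφ.pow i).prodMk (hφ.pow j))).sub (hH.comp ((hφ.pow i).prodMk contDiff_const))
  have hφ0 : φ t₀ = 0 := by simp [hφψ]
  refine .of_tendsto (uniqueDiffWithinAt_iff_accPt.1 (hI.uniqueDiffOn hI' t₀ ht₀))
    (.of_contDiffOn hI hI' ht₀ hs.contDiffOn) ?_
  have hstrict := (hH.contDiffAt (x := 0)).hasStrictFDerivAt (by simp)
  have ht : Tendsto (fun t => ((φ t ^ i, φ t ^ j), ((φ t ^ i, 0) : ℝ × ℝ))) (𝓝[I \ {t₀}] t₀)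
      (𝓝 ((0 : ℝ × ℝ), (0 : ℝ × ℝ))) := by
    have hc := hφ.continuous
    refine (Continuous.tendsto' (by fun_prop) _ _ ?_).mono_left nhdsWithin_le_nhds
    simp [hφ0, hi, hj]
  have h1 := hstrict.isLittleO.comp_tendsto ht
  have h2 : (fun t => ((φ t ^ i, φ t ^ j) : ℝ × ℝ) - (φ t ^ i, 0))
      =O[𝓝[I \ {t₀}] t₀] fun t => (t - t₀) ^ j := by
    have h3 : (fun t => ψ t ^ j) =O[𝓝[I \ {t₀}] t₀] fun _ => (1 : ℝ) :=
      (((hψ.continuous.pow j).continuousAt (x := t₀)).isBigO_one ℝ).mono nhdsWithin_le_nhds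
    have h4 := (Asymptotics.isBigO_refl (fun t => (t - t₀) ^ j) (𝓝[I \ {t₀}] t₀)).mul h3
    simp only [mul_one] at h4
    refine Asymptotics.IsBigO.congr_left ((Asymptotics.isBigO_zero _ _).prod_left h4) fun t => ?_
    ext <;> simp [hφψ, mul_pow]
  have h3 := (h1.trans_isBigO h2).tendsto_div_nhds_zero
  have h4 : Tendsto (fun t => ψ t ^ j * fderiv ℝ H 0 (0, 1)) (𝓝[I \ {t₀}] t₀)
      (𝓝 (ψ t₀ ^ j * fderiv ℝ H 0 (0, 1))) :=
    (((hψ.continuous.pow j).mul continuous_const).tendsto t₀).mono_left nhdsWithin_le_nhds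
  have h5 := h3.add h4
  rw [zero_add] at h5
  refine h5.congr' ?_
  filter_upwards [self_mem_nhdsWithin] with t ht
  have h6 : (t - t₀) ^ j ≠ 0 := pow_ne_zero _ (sub_ne_zero.2 ht.2)
  have h7 : ((φ t ^ i, φ t ^ j) : ℝ × ℝ) - (φ t ^ i, 0) = φ t ^ j • ((0 : ℝ), (1 : ℝ)) := by
    ext <;> simp
  simp only [Function.comp_apply]
  have h8 : φ t ^ j = (t - t₀) ^ j * ψ t ^ j := by rw [hφψ, mul_pow]
  rw [h7, map_smul, smul_eq_mul, div_add' _ _ _ h6]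
  congr 1
  linear_combination -fderiv ℝ H 0 (0, 1) * h8

theorem fderiv_apply_one_zero {H : ℝ × ℝ → ℝ} (hH : ContDiff ℝ ∞ H) {g : ℝ → ℝ}
    (hg : ContDiff ℝ ∞ g) (hHg : ∀ u, H (u, 0) = u * g u) : fderiv ℝ H 0 (1, 0) = g 0 := by
  have h1 : HasFDerivAt H (fderiv ℝ H 0) ((0 : ℝ), (0 : ℝ)) :=
    (hH.differentiable (by simp)).differentiableAt.hasFDerivAt
  have h0 : HasDerivAt (fun u : ℝ => (u, (0 : ℝ))) (1, 0) 0 :=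
    (hasDerivAt_id (0 : ℝ)).prodMk (hasDerivAt_const (0 : ℝ) (0 : ℝ))
  have h2 := h1.comp_hasDerivAt (f := fun u : ℝ => (u, (0 : ℝ))) (0 : ℝ) h0
  have h3 : HasDerivAt g (deriv g 0) 0 :=
    (hg.differentiable (by simp)).differentiableAt.hasDerivAt
  have h4 : HasDerivAt (fun u => H (u, 0)) (g 0) 0 := by
    rw [funext hHg]
    exact ((hasDerivAt_id (0 : ℝ)).fun_mul h3).congr_deriv (by simp)
  exact h2.unique h4

/-- If the involute is equivalent to the monomial curve, its coordinate `x` has order `i`, and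
`y - K x ^ 2` has order `j` once `K` is chosen to remove the term of order `2 i`. -/
theorem IsInvoluteCoordinates.exists_leading {x y a b p q : ℝ → ℝ}
    (D : IsInvoluteCoordinates I t₀ ε m n s x y a b p q) {G : ℝ × ℝ → ℝ × ℝ}
    (hG : IsDiffeoGerm univ 0 univ 0 G) {φ : ℝ → ℝ} (hφ : IsDiffeoGerm univ t₀ univ 0 φ)
    {i j : ℕ} (hi : i ≠ 0) (hij : i < j) (hji : j < 3 * i)
    (hxy : ∀ᶠ t in 𝓝[I] t₀, (x t, y t) = G (φ t ^ i, φ t ^ j)) :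
    ∃ K, (∃ l ≠ 0, HasLeadingTerm I t₀ i l x) ∧
      ∃ l ≠ 0, HasLeadingTerm I t₀ j l fun t => y t - K * x t ^ 2 := by
  have hj : j ≠ 0 := by omega
  -- a global parameter `f`, and global components `H₁`, `H₂` of `G`
  obtain ⟨U, hU, hφU⟩ := hφ.exists_contDiffOn
  obtain ⟨f, hf, hfφ⟩ := exists_contDiff_eventuallyEq hφU hU
  obtain ⟨W, hW, hGW⟩ := hG.exists_contDiffOn
  obtain ⟨H₁, hH₁, hGH₁⟩ := exists_contDiff_eventuallyEq (contDiff_fst.comp_contDiffOn hGW) hW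
  obtain ⟨H₂, hH₂, hGH₂⟩ := exists_contDiff_eventuallyEq (contDiff_snd.comp_contDiffOn hGW) hW
  have hf0 : f t₀ = 0 := by rw [hfφ.eq_of_nhds, hφ.apply_eq]
  obtain ⟨ψ, hψ, hfψ⟩ := exists_eq_add_sub_mul hf t₀
  simp only [hf0, zero_add] at hfψ
  have hψ0 : ψ t₀ ≠ 0 := fun h0 => by
    have h1 : HasDerivAt ψ (deriv ψ t₀) t₀ :=
      (hψ.differentiable (by simp)).differentiableAt.hasDerivAt
    have h2 : HasDerivAt f 0 t₀ := by
      rw [funext hfψ]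
      exact (((hasDerivAt_id t₀).sub_const t₀).fun_mul h1).congr_deriv (by simp [h0])
    have h3 := hφ.injective_fderiv (a₁ := (1 : ℝ)) (a₂ := 0)
    rw [← hfφ.fderiv_eq, h2.hasFDerivAt.fderiv] at h3
    simp at h3
  have hft : Tendsto (fun t => (f t ^ i, f t ^ j)) (𝓝 t₀) (𝓝 (0 : ℝ × ℝ)) := by
    have hc := hf.continuous
    exact Continuous.tendsto' (by fun_prop) _ _ (by simp [hf0, hi, hj])
  have hx : ∀ᶠ t in 𝓝[I] t₀, x t = H₁ (f t ^ i, f t ^ j) := by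
    filter_upwards [hxy, nhdsWithin_le_nhds hfφ, nhdsWithin_le_nhds (hft.eventually hGH₁)]
      with t h1 h2 h3
    rw [h3, h2, Function.comp_apply, ← h1]
  have hy : ∀ᶠ t in 𝓝[I] t₀, y t = H₂ (f t ^ i, f t ^ j) := by
    filter_upwards [hxy, nhdsWithin_le_nhds hfφ, nhdsWithin_le_nhds (hft.eventually hGH₂)]
      with t h1 h2 h3
    rw [h3, h2, Function.comp_apply, ← h1]
  have hinj : ∀ v : ℝ × ℝ, fderiv ℝ H₁ 0 v = 0 → fderiv ℝ H₂ 0 v = 0 → v = 0 := fun v h1 h2 => by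
    have h3 : HasFDerivAt G ((fderiv ℝ H₁ 0).prod (fderiv ℝ H₂ 0)) 0 :=
      ((hH₁.differentiable (by simp)).differentiableAt.hasFDerivAt.prodMk
        (hH₂.differentiable (by simp)).differentiableAt.hasFDerivAt).congr_of_eventuallyEq (by
          filter_upwards [hGH₁, hGH₂] with z h1 h2
          rw [h1, h2]; rfl)
    have h4 := hG.injective_fderiv
    rw [h3.fderiv, injective_iff_map_eq_zero] at h4
    exact h4 v (by simp [h1, h2])
  have hH₁0 : H₁ (0, 0) = 0 := by
    have := hGH₁.eq_of_nhds
    rw [Function.comp_apply, hG.apply_eq] at this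
    exact this
  have hH₂0 : H₂ (0, 0) = 0 := by
    have := hGH₂.eq_of_nhds
    rw [Function.comp_apply, hG.apply_eq] at this
    exact this
  obtain ⟨g₁, hg₁, hHg₁⟩ := exists_eq_add_sub_mul
    (hH₁.comp (contDiff_id.prodMk (contDiff_const (c := (0 : ℝ))))) 0
  obtain ⟨g₂, hg₂, hHg₂⟩ := exists_eq_add_sub_mul
    (hH₂.comp (contDiff_id.prodMk (contDiff_const (c := (0 : ℝ))))) 0
  simp only [Function.comp_apply, id, hH₁0, hH₂0, zero_add, sub_zero] at hHg₁ hHg₂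
  have hd₁ := fderiv_apply_one_zero hH₁ hg₁ hHg₁
  have hd₂ := fderiv_apply_one_zero hH₂ hg₂ hHg₂
  have hL : HasLeadingTerm I t₀ 1 (ψ t₀) f :=
    ⟨ψ, hψ, rfl, Eventually.of_forall fun t => by rw [hfψ, pow_one]⟩
  have hLi : ∀ g : ℝ → ℝ, ContDiff ℝ ∞ g → HasLeadingTerm I t₀ 0 (g 0) fun t => g (f t ^ i) :=
    fun g hg => (D.leading_zero (hg.comp (hf.pow i)).contDiffOn).congr_coeff (by simp [hf0, hi])
  have hfirst : ∀ {H : ℝ × ℝ → ℝ} {g w : ℝ → ℝ}, ContDiff ℝ ∞ H → ContDiff ℝ ∞ g →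
      (∀ u, H (u, 0) = u * g u) → (∀ᶠ t in 𝓝[I] t₀, w t = H (f t ^ i, f t ^ j)) →
      HasLeadingTerm I t₀ i (ψ t₀ ^ i * g 0) w := fun {H g w} hH hg hHg hw => by
    obtain ⟨e, he, rfl⟩ : ∃ e, e ≠ 0 ∧ j = i + e := ⟨j - i, by omega, by omega⟩
    have h1 := (leading_comp_monomial_sub hH D.ordConnected D.nontrivial D.mem hi hj hf hψ
      hfψ).of_add he
    have h2 := (hL.pow i).mul (hLi g hg)
    rw [one_mul, add_zero] at h2
    refine ((h1.add h2).congr_coeff (zero_add _)).congr ?_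
    filter_upwards [hw] with t ht
    rw [ht, hHg]; ring
  have hxl := hfirst hH₁ hg₁ hHg₁ hx
  have hyl := hfirst hH₂ hg₂ hHg₂ hy
  -- the tangent direction of `G` along the first axis is that of the involute
  have hg₂0 : g₂ 0 = 0 := by
    obtain ⟨i, rfl⟩ := Nat.exists_eq_succ_of_ne_zero hi
    have h1 := hxl.hasDerivWithinAt D.uniqueDiffOn D.deriv_x
    have h2 := hyl.hasDerivWithinAt D.uniqueDiffOn D.deriv_y
    have h3 := HasLeadingTerm.of_mul (n := i) D.accPt (D.leading_zero
      (D.smooth_s.mul D.smooth_k)) (D.leading_zero D.smooth_a) (by simp [D.a_one]) h1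
    have h4 := h2.unique D.accPt (h3.mul (D.leading_zero D.smooth_b))
    have hi' : (i : ℝ) + 1 ≠ 0 := by positivity
    simpa [D.b_zero, hψ0, hi'] using h4
  have hg₁0 : g₁ 0 ≠ 0 := fun h => by
    simpa using hinj (1, 0) (by rw [hd₁, h]) (by rw [hd₂, hg₂0])
  have hβ : fderiv ℝ H₂ 0 (0, 1) ≠ 0 := fun h => by
    have e : ∀ H : ℝ × ℝ → ℝ, fderiv ℝ H 0 (fderiv ℝ H₁ 0 (0, 1), -g₁ 0)
        = fderiv ℝ H₁ 0 (0, 1) * fderiv ℝ H 0 (1, 0) + -g₁ 0 * fderiv ℝ H 0 (0, 1) := fun H => by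
      rw [← smul_eq_mul, ← smul_eq_mul, ← map_smul, ← map_smul, ← map_add]
      simp
    have h1 := hinj (fderiv ℝ H₁ 0 (0, 1), -g₁ 0) (by rw [e, hd₁]; ring)
      (by rw [e, hd₂, hg₂0, h]; ring)
    exact hg₁0 (neg_eq_zero.1 (congrArg Prod.snd h1))
  obtain ⟨k₁, hk₁, hgk₁⟩ := exists_eq_add_sub_mul hg₁ 0
  obtain ⟨k₂, hk₂, hgk₂⟩ := exists_eq_add_sub_mul hg₂ 0
  obtain ⟨r₂, hr₂, hkr₂⟩ := exists_eq_add_sub_mul hk₂ 0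
  simp only [hg₂0, zero_add, sub_zero] at hgk₁ hgk₂ hkr₂
  set K := k₂ 0 / g₁ 0 ^ 2 with hK
  have hK' : k₂ 0 = K * g₁ 0 ^ 2 := by rw [hK]; field_simp
  refine ⟨K, ⟨_, mul_ne_zero (pow_ne_zero _ hψ0) hg₁0, hxl⟩, _,
    mul_ne_zero (pow_ne_zero j hψ0) hβ, ?_⟩
  -- `H₂ - K H₁ ^ 2` vanishes to third order along the first axis
  set H : ℝ × ℝ → ℝ := fun z => H₂ z - K * H₁ z ^ 2 with hH
  have hHs : ContDiff ℝ ∞ H := by fun_prop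
  set r : ℝ → ℝ := fun u => r₂ u - K * (2 * g₁ 0 * k₁ u + u * k₁ u ^ 2) with hr
  have hrs : ContDiff ℝ ∞ r := by fun_prop
  have hHr : ∀ u, H (u, 0) = u ^ 3 * r u := fun u => by
    simp only [hH, hr, hHg₁, hHg₂, hgk₁ u, hgk₂ u, hkr₂ u, hK']
    ring
  have hHd : fderiv ℝ H 0 = fderiv ℝ H₂ 0 := by
    have h1 : HasFDerivAt H₁ (fderiv ℝ H₁ 0) 0 :=
      (hH₁.differentiable (by simp)).differentiableAt.hasFDerivAt
    have h2 : HasFDerivAt H₂ (fderiv ℝ H₂ 0) 0 :=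
      (hH₂.differentiable (by simp)).differentiableAt.hasFDerivAt
    have h3 : H₁ 0 = 0 := hH₁0
    refine ((h2.sub ((h1.pow 2).const_mul K)).congr_fderiv ?_).fderiv
    simp [h3]
  obtain ⟨e, he, hje⟩ : ∃ e, e ≠ 0 ∧ i * 3 = j + e := ⟨i * 3 - j, by omega, by omega⟩
  have h1 := leading_comp_monomial_sub hHs D.ordConnected D.nontrivial D.mem hi hj hf hψ hfψ
  have h2 := ((hL.pow i).pow 3).mul (hLi r hrs)
  rw [one_mul, add_zero, hje] at h2
  refine ((h1.add (h2.of_add he)).congr_coeff (by rw [hHd, add_zero])).congr ?_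
  filter_upwards [hx, hy] with t h3 h4
  rw [h3, h4, ← hHr, sub_add_cancel]

theorem isDiffeoGerm_sub_sq (K : ℝ) :
    IsDiffeoGerm (univ : Set (ℝ × ℝ)) 0 univ 0 fun z => (z.1, z.2 - K * z.1 ^ 2) :=
  isDiffeoGerm_prodMk_fst (by fun_prop) (by simp) (d := 1)
    ((hasDerivAt_id' (0 : ℝ)).congr_of_eventuallyEq (Eventually.of_forall fun y => by simp))
    one_ne_zero

/-- In the chart of the frame the curve has components of orders `i` and `j`, up to the shear by
`K x ^ 2`. -/
theorem IsLorentzFrame.hasCuspAt {c : ℝ → Fin 3 → ℝ} {e₁ e₂ : Fin 3 → ℝ}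
    (hf : IsLorentzFrame (c t₀) e₁ e₂) {i j : ℕ}
    (hij : (i = 2 ∧ (j = 3 ∨ j = 5)) ∨ (i = 3 ∧ (j = 4 ∨ j = 5))) {K l l' : ℝ} (hl : l ≠ 0)
    (hl' : l' ≠ 0) (hx : HasLeadingTerm I t₀ i l fun t => lorentz (c t) e₁)
    (hz : HasLeadingTerm I t₀ j l' fun t => lorentz (c t) e₂ - K * lorentz (c t) e₁ ^ 2) :
    HasCuspAt i j I c t₀ := by
  obtain ⟨X, hX, hX0, hxX⟩ := hx
  obtain ⟨Z, hZ, hZ0, hzZ⟩ := hz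
  obtain ⟨φ, F, hφ, hF, he⟩ := isPlaneCusp_of_order (i := i) (j := j) hij
    (X := fun t => X (t + t₀)) (Z := fun t => Z (t + t₀)) (by fun_prop) (by fun_prop)
    (by simpa [hX0]) (by simpa [hZ0])
  have hsub : IsDiffeoGerm univ t₀ univ 0 fun t => t - t₀ :=
    isDiffeoGerm_of_deriv_ne_zero (by fun_prop) ((hasDerivAt_id t₀).sub_const t₀) one_ne_zero
      (sub_self t₀)
  obtain ⟨F', hF', hl, -⟩ := hF.exists_inverse
  rw [nhdsWithin_univ] at hl
  refine ⟨_, _, hφ.comp hsub, hF'.comp ((isDiffeoGerm_sub_sq K).comp hf.isDiffeoGerm), ?_⟩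
  have ht : Tendsto (fun t => (φ t ^ i, φ t ^ j)) (𝓝 0) (𝓝 (0 : ℝ × ℝ)) := by
    have h1 := (hφ.tendsto.pow i).prodMk_nhds (hφ.tendsto.pow j)
    rwa [zero_pow (by omega), zero_pow (by omega)] at h1
  filter_upwards [hxX, hzZ, nhdsWithin_le_nhds (hsub.tendsto.eventually he),
    nhdsWithin_le_nhds (hsub.tendsto.eventually (ht.eventually hl))] with t h1 h2 h3 h4
  simp only [sub_add_cancel] at h3
  simp only [Function.comp_apply]
  rw [h1, ← h4, ← h3]
  rw [h1] at h2
  rw [h2]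

/-- In the chart of the frame, a cusp is the image of the monomial curve under a diffeomorphism. -/
theorem HasCuspAt.exists_monomial {c : ℝ → Fin 3 → ℝ} {e₁ e₂ : Fin 3 → ℝ} {i j : ℕ}
    (h : HasCuspAt i j I c t₀) (hf : IsLorentzFrame (c t₀) e₁ e₂)
    (hc : ContinuousWithinAt c I t₀) (hc' : MapsTo c I hyperbolicPlane) :
    ∃ (φ : ℝ → ℝ) (G : ℝ × ℝ → ℝ × ℝ), IsDiffeoGerm univ t₀ univ 0 φ ∧
      IsDiffeoGerm univ 0 univ 0 G ∧
      ∀ᶠ t in 𝓝[I] t₀, (lorentz (c t) e₁, lorentz (c t) e₂) = G (φ t ^ i, φ t ^ j) := by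
  obtain ⟨φ, Φ, hφ, hΦ, he⟩ := h
  obtain ⟨Ψ, hΨ, hl, -⟩ := hΦ.exists_inverse
  refine ⟨φ, _, hφ, hf.isDiffeoGerm.comp hΨ, ?_⟩
  filter_upwards [he, (hc.tendsto_nhdsWithin hc').eventually hl] with t h1 h2
  rw [← h1, Function.comp_apply, h2]

end Criterion

/-! ### Singularities of the involute -/

/-- A cusp of the involute is detected by the orders of its coordinates along the tangent and the
normal at `t₀`, the second one corrected by a multiple of the square of the first. -/
theorem hasCuspAt_involute_iff {I : Set ℝ} {t₀ ε : ℝ} {m n s : ℝ → ℝ} {γ ν : ℝ → Fin 3 → ℝ}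
    (hI : I.OrdConnected) (hI' : I.Nontrivial)
    (h : IsSpacelikeLegendreCurve I γ ν) (hmn : IsLegendreCurvature I γ ν m n)
    (hε : ε = 1 ∨ ε = -1) (hs : IsInvoluteSolution I ε m n s) (ht₀ : t₀ ∈ I) {i j : ℕ}
    (hij : (i = 2 ∧ (j = 3 ∨ j = 5)) ∨ (i = 3 ∧ (j = 4 ∨ j = 5))) :
    HasCuspAt i j I (horocyclicInvolute ε γ ν s) t₀ ↔
      ∃ K, (∃ l ≠ 0, HasLeadingTerm I t₀ i l
          fun t => lorentz (horocyclicInvolute ε γ ν s t) (involuteTangent ε γ ν s t₀)) ∧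
        ∃ l ≠ 0, HasLeadingTerm I t₀ j l
          fun t => lorentz (horocyclicInvolute ε γ ν s t) (involuteNormal ε γ ν s t₀) -
            K * lorentz (horocyclicInvolute ε γ ν s t) (involuteTangent ε γ ν s t₀) ^ 2 := by
  have hf := involute_frame (s := s) h hε ht₀
  constructor
  · intro hc
    obtain ⟨φ, G, hφ, hG, he⟩ := hc.exists_monomial hf
      (hasDerivWithinAt_horocyclicInvolute h hmn hs hε ht₀).continuousWithinAt
      fun t ht => ⟨(involute_frame h hε ht).self₀, (involute_frame h hε ht).pos⟩
    exact (isInvoluteCoordinates hI hI' h hmn hε hs ht₀).exists_leading hG hφ (by omega)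
      (by omega) (by omega) he
  · rintro ⟨K, ⟨l, hl, h1⟩, l', hl', h2⟩
    exact hf.hasCuspAt hij hl hl' h1 h2

theorem isSingularAt_involute_iff {I : Set ℝ} {t₀ ε : ℝ} {m n s : ℝ → ℝ} {γ ν : ℝ → Fin 3 → ℝ}
    (hI : UniqueDiffOn ℝ I) (h : IsSpacelikeLegendreCurve I γ ν)
    (hmn : IsLegendreCurvature I γ ν m n) (hε : ε = 1 ∨ ε = -1)
    (hs : IsInvoluteSolution I ε m n s) (ht₀ : t₀ ∈ I) :
    IsSingularAt I (horocyclicInvolute ε γ ν s) t₀ ↔ s t₀ * (n t₀ + ε * m t₀) = 0 := by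
  have hw : involuteTangent ε γ ν s t₀ ≠ 0 := fun h0 => by
    have := (involute_frame (s := s) h hε ht₀).self₁
    simp [h0, lorentz] at this
  rw [IsSingularAt, (hasDerivWithinAt_horocyclicInvolute h hmn hs hε ht₀).derivWithin (hI t₀ ht₀),
    smul_eq_zero, or_iff_left hw]

theorem corollary4p8 (I : Set ℝ) (hI : I.OrdConnected) (hI' : I.Nontrivial)
    (γ ν : ℝ → Fin 3 → ℝ) (hγν : IsSpacelikeLegendreCurve I γ ν)
    (m n : ℝ → ℝ) (hmn : IsLegendreCurvature I γ ν m n)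
    (ε : ℝ) (hε : ε = 1 ∨ ε = -1)
    (s : ℝ → ℝ) (hs : IsInvoluteSolution I ε m n s)
    (t₀ : ℝ) (ht₀ : t₀ ∈ I) :
    (IsSingularAt I (horocyclicInvolute ε γ ν s) t₀ ↔ s t₀ * (n t₀ + ε * m t₀) = 0) ∧
    (HasCuspAt 2 3 I (horocyclicInvolute ε γ ν s) t₀ ↔
      s t₀ = 0 ∧ m t₀ ≠ 0 ∧ n t₀ + ε * m t₀ ≠ 0) ∧
    (HasCuspAt 3 4 I (horocyclicInvolute ε γ ν s) t₀ ↔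
      s t₀ = 0 ∧ m t₀ = 0 ∧ n t₀ ≠ 0 ∧ derivWithin m I t₀ ≠ 0) ∧
    (HasCuspAt 2 5 I (horocyclicInvolute ε γ ν s) t₀ ↔
      n t₀ + ε * m t₀ = 0 ∧ derivWithin n I t₀ + ε * derivWithin m I t₀ ≠ 0 ∧
        s t₀ ≠ 0 ∧ m t₀ ≠ 0) ∧
    (HasCuspAt 3 5 I (horocyclicInvolute ε γ ν s) t₀ ↔
      s t₀ = 0 ∧ n t₀ + ε * m t₀ = 0 ∧
        derivWithin n I t₀ + ε * derivWithin m I t₀ ≠ 0 ∧ m t₀ ≠ 0) := by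
  have hcusp := fun {i j : ℕ} => hasCuspAt_involute_iff (i := i) (j := j) hI hI' hγν hmn hε hs ht₀
  have D := isInvoluteCoordinates hI hI' hγν hmn hε hs ht₀
  exact ⟨isSingularAt_involute_iff (hI.uniqueDiffOn hI') hγν hmn hε hs ht₀,
    (hcusp (by simp)).trans D.leading_iff_two_three,
    (hcusp (by simp)).trans D.leading_iff_three_four,
    (hcusp (by simp)).trans D.leading_iff_two_five,
    (hcusp (by simp)).trans D.leading_iff_three_five⟩
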